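/- Let $T>0$, let $b\colon\mathbb{R}^d\times[0,T]\to\mathbb{R}^d$ be a Borel vector field, and let $\nu$ be a locally bounded Borel measure on $\mathbb{R}^d$, i.e., a real function on the bounded Borel sets that is countably additive on the Borel subsets of every compact set (such measures may be signed; locally bounded Borel measures on $\mathbb{R}^d\times[0,T]$ are defined similarly). A locally bounded Borel measure $\mu$ on $\mathbb{R}^d\times[0,T]$ is given by a family $(\mu_t)_{t\in[0,T]}$ of locally bounded Borel measures on $\mathbb{R}^d$, written $\mu=\mu_t(dx)\,dt$, if $t\mapsto\mu_t(B)$ is measurable for every bounded Borel set $B$, $t\mapsto|\mu_t|(K)$ is in $L^1[0,T]$ for every compact $K$, and $\int u\,d\mu=\int_0^T\int_{\mathbb{R}^d}u(x,t)\,\mu_t(dx)\,dt$ for every bounded Borel function $u$ on $\mathbb{R}^d\times[0,T]$ vanishing for $x$ outside a ball. Such a $\mu$ is a solution to the Cauchy problem $$\partial_t\mu+\mathrm{div}(b\mu)=0,\qquad \mu|_{t=0}=\nu, \tag{1}$$ if $b\in L^1(|\mu|,U\times[0,T])$ for every ball $U\subset\mathbb{R}^d$ and, for every function $u$ that is continuous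 on $\mathbb{R}^d\times[0,T)$ along with its first order derivatives in $t$ and $x$ and satisfies $u(x,t)=0$ whenever $|x|>R$, for some $R$, one has $$\int_{\mathbb{R}^d}u(x,t)\,\mu_t(dx)=\int_{\mathbb{R}^d}u(x,0)\,\nu(dx)+\int_0^t\int_{\mathbb{R}^d}\bigl[\partial_tu+\langle b,\nabla u\rangle\bigr]\,\mu_s(dx)\,ds$$ for almost every $t\in[0,T]$. Theorem. Let $\mu^1=\mu^1_t(dx)\,dt$ and $\mu^2=\mu^2_t(dx)\,dt$ be two solutions to the Cauchy problem (1). Assume that the measure $\mu=\mu_t(dx)\,dt$, where $\mu_t=\mu^1_t-\mu^2_t$, satisfies the following conditions: (i) $\displaystyle\lim_{N\to\infty}N^{-1}\int_0^T\int_{N<|x|<2N}|b(x,t)|\,|\mu_t|(dx)\,dt=0$; for every open ball $U\subset\mathbb{R}^d$ one can find numbers $C>0$ and $\delta>0$, a sequence of vector fields $b_k\in C^\infty(U\times\mathbb{R},\mathbb{R}^d)$ and a sequence of positive functions $V_k\in C^1(U)$ (all depending on $\mu$ and $U$) such that (ii) $\inf_k\inf_UV_k>0$ and, for every $k$ and all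 $(x,t)\in U\times[0,T]$, $$\langle b_k(x,t),\nabla V_k(x)\rangle\le\Bigl(C-\delta|b_k(x,t)|^2-2\max_{|\xi|=1}\langle\mathcal{B}_k(x,t)\xi,\xi\rangle\Bigr)V_k(x),\qquad \mathcal{B}_k=(\partial_{x_i}b_k^j)_{i,j\le d},$$ (iii) $\displaystyle\lim_{k\to\infty}\int_0^T\int_U|b_k-b|\sqrt{V_k}\,d|\mu_t|\,dt=0$. Then $\mu=0$, i.e., $\mu^1=\mu^2$; equivalently, $\mu^1_t=\mu^2_t$ for almost every $t\in[0,T]$. -/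

import Mathlib

open MeasureTheory Filter Topology Set
open scoped ENNReal ContDiff

noncomputable section

/-- A locally bounded (signed) Borel measure on a metric space `X`: a real function on the bounded
Borel sets that is countably additive on the class of Borel subsets of every compact set.  The value
on a set that is not a bounded Borel set is set to `0`, so that equality is equality on the bounded
Borel sets. -/
structure LocBddMeasure (X : Type*) [PseudoMetricSpace X] [MeasurableSpace X] where
  toFun : Set X → ℝ
  junk' : ∀ A : Set X, ¬ (MeasurableSet A ∧ Bornology.IsBounded A) → toFun A = 0
  hasSum' : ∀ K : Set X, IsCompact K → ∀ A : ℕ → Set X, (∀ i, MeasurableSet (A i)) →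
    (∀ i, A i ⊆ K) → Pairwise (fun i j => Disjoint (A i) (A j)) →
    HasSum (fun i => toFun (A i)) (toFun (⋃ i, A i))

namespace LocBddMeasure

section General

variable {X : Type*} [PseudoMetricSpace X] [MeasurableSpace X]

instance : CoeFun (LocBddMeasure X) (fun _ => Set X → ℝ) := ⟨LocBddMeasure.toFun⟩

/-- The difference of two locally bounded measures. -/
instance : Sub (LocBddMeasure X) where
  sub m n :=
    { toFun := fun A => m A - n A
      junk' := fun A hA => by simp [m.junk' A hA, n.junk' A hA]
      hasSum' := fun K hK A hA hAK hd =>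
        (m.hasSum' K hK A hA hAK hd).sub (n.hasSum' K hK A hA hAK hd) }

theorem empty_eq_zero (m : LocBddMeasure X) : m ∅ = 0 := by
  have h := m.hasSum' ∅ isCompact_empty (fun _ => ∅) (fun _ => MeasurableSet.empty)
    (fun _ => subset_rfl) (fun _ _ _ => disjoint_bot_left)
  have h2 := h.summable.tendsto_atTop_zero
  exact tendsto_nhds_unique tendsto_const_nhds h2

open Classical in
/-- The finite signed measure `A ↦ m (A ∩ S)`, for a bounded Borel set `S`. -/
def restr [ProperSpace X] (m : LocBddMeasure X) (S : Set X) (hS : MeasurableSet S)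
    (hb : Bornology.IsBounded S) : SignedMeasure X where
  measureOf' A := if MeasurableSet A then m (A ∩ S) else 0
  empty' := by simp [empty_eq_zero]
  not_measurable' A hA := by simp [hA]
  m_iUnion' A hA hd := by
    have h := m.hasSum' (closure S) hb.isCompact_closure (fun i => A i ∩ S)
      (fun i => (hA i).inter hS) (fun i => inter_subset_right.trans subset_closure)
      (fun i j hij => (hd hij).mono inter_subset_left inter_subset_left)
    simpa [hA, MeasurableSet.iUnion hA, iUnion_inter] using h

end General

section Normed

variable {E : Type*} [NormedAddCommGroup E] [MeasurableSpace E] [BorelSpace E]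

/-- The shells `{n ≤ |x| < n + 1}`, a partition of the space into bounded Borel sets. -/
def shell (E : Type*) [NormedAddCommGroup E] (n : ℕ) : Set E :=
  {x | (n : ℝ) ≤ ‖x‖ ∧ ‖x‖ < n + 1}

theorem isBounded_shell {E : Type*} [NormedAddCommGroup E] (n : ℕ) :
    Bornology.IsBounded (shell E n) :=
  Metric.isBounded_ball.subset (fun x hx => by
    simpa [Metric.mem_ball, dist_zero_right] using hx.2 : shell E n ⊆ Metric.ball 0 ((n : ℝ) + 1))

theorem measurableSet_shell (n : ℕ) : MeasurableSet (shell E n) :=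
  (measurableSet_le measurable_const measurable_norm).inter
    (measurableSet_lt measurable_norm measurable_const)

variable [ProperSpace E]

/-- The positive part `m⁺` in the Hahn–Jordan decomposition `m = m⁺ - m⁻`: the sum over the shells
of the positive parts of the restrictions of `m` to the shells. -/
def posPart (m : LocBddMeasure E) : Measure E :=
  Measure.sum fun n : ℕ =>
    (m.restr (shell E n) (measurableSet_shell n)
      (isBounded_shell n)).toJordanDecomposition.posPart

/-- The negative part `m⁻` in the Hahn–Jordan decomposition `m = m⁺ - m⁻`. -/
def negPart (m : LocBddMeasure E) : Measure E :=
  Measure.sum fun n : ℕ =>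
    (m.restr (shell E n) (measurableSet_shell n)
      (isBounded_shell n)).toJordanDecomposition.negPart

/-- The total variation `|m| = m⁺ + m⁻`. -/
def variation (m : LocBddMeasure E) : Measure E := m.posPart + m.negPart

/-- The integral `∫ u dm = ∫ u dm⁺ - ∫ u dm⁻`, for `|m|`-integrable `u`. -/
def integral (m : LocBddMeasure E) (u : E → ℝ) : ℝ :=
  (∫ x, u x ∂m.posPart) - ∫ x, u x ∂m.negPart

end Normed

end LocBddMeasure

section ContinuityEquation

variable {d : ℕ}

/-- The measure `μ` on `ℝ^d × [0, T]` is given by the family `(m t)`, `t ∈ [0, T]`, of locally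
bounded measures: `μ = m_t(dx) dt`. -/
structure IsGivenBy (T : ℝ) (μ : LocBddMeasure (EuclideanSpace ℝ (Fin d) × Icc (0 : ℝ) T))
    (m : ℝ → LocBddMeasure (EuclideanSpace ℝ (Fin d))) : Prop where
  aemeasurable : ∀ B : Set (EuclideanSpace ℝ (Fin d)), MeasurableSet B → Bornology.IsBounded B →
    AEMeasurable (fun t => m t B) (volume.restrict (Icc 0 T))
  integrable : ∀ K : Set (EuclideanSpace ℝ (Fin d)), IsCompact K →
    IntegrableOn (fun t => ((m t).variation K).toReal) (Icc 0 T)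
  eq_integral : ∀ B : Set (EuclideanSpace ℝ (Fin d) × Icc (0 : ℝ) T), MeasurableSet B →
    Bornology.IsBounded B → μ B =
      ∫ t : Icc (0 : ℝ) T, m t {x | (x, t) ∈ B} ∂(Measure.comap Subtype.val (volume : Measure ℝ))

/-- The class `C^{1,1}(ℝ^d × [0, T))` of functions with continuous first order derivatives in
`(x, t)` (one-sided in `t` at `t = 0`), with `u(x, t) = 0` for `|x| > R`, for some `R`. -/
structure IsTestFunction (T : ℝ) (u : EuclideanSpace ℝ (Fin d) → ℝ → ℝ) : Prop where
  contDiffOn : ContDiffOn ℝ 1 (fun p : EuclideanSpace ℝ (Fin d) × ℝ => u p.1 p.2)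
    (univ ×ˢ Ico 0 T)
  support : ∃ R : ℝ, ∀ x, R < ‖x‖ → ∀ t ∈ Ico 0 T, u x t = 0

/-- `μ = m_t(dx) dt` is a solution on `[0, T]` to the Cauchy problem
`∂_t μ + div (b μ) = 0`, `μ|_{t=0} = ν`. -/
structure IsSolution (T : ℝ) (b : EuclideanSpace ℝ (Fin d) → ℝ → EuclideanSpace ℝ (Fin d))
    (ν : LocBddMeasure (EuclideanSpace ℝ (Fin d)))
    (μ : LocBddMeasure (EuclideanSpace ℝ (Fin d) × Icc (0 : ℝ) T))
    (m : ℝ → LocBddMeasure (EuclideanSpace ℝ (Fin d))) : Prop where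
  isGivenBy : IsGivenBy T μ m
  /-- `b ∈ L¹(|μ|, U × [0, T])` for every ball `U`. -/
  integrable_drift : ∀ (z : EuclideanSpace ℝ (Fin d)) (r : ℝ), 0 < r →
    ∫⁻ t in Icc 0 T, ∫⁻ x in Metric.ball z r, ‖b x t‖ₑ ∂(m t).variation < ⊤
  equation : ∀ u : EuclideanSpace ℝ (Fin d) → ℝ → ℝ, IsTestFunction T u →
    ∀ᵐ t ∂(volume.restrict (Icc 0 T)),
      (m t).integral (fun x => u x t) = ν.integral (fun x => u x 0) +
        ∫ s in (0 : ℝ)..t, (m s).integral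
          (fun x => deriv (fun τ => u x τ) s + inner ℝ (b x s) (gradient (fun y => u y s) x))

/-- `max_{|ξ| = 1} ⟨A ξ, ξ⟩`. -/
def maxQuadForm (A : EuclideanSpace ℝ (Fin d) →L[ℝ] EuclideanSpace ℝ (Fin d)) : ℝ :=
  sSup ((fun ξ => inner ℝ (A ξ) ξ) '' Metric.sphere (0 : EuclideanSpace ℝ (Fin d)) 1)

end ContinuityEquation

end

/-! The proof is by duality. The difference `n` of the two solutions solves the equation with zero
initial data, and it suffices to show, for each smooth compactly supported `ψ`, that `∫ ψ dn_t = 0`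
for almost every `t`. Ideally one tests with `φ f`, where `f` solves the backward transport equation
`∂_s f + ⟨b_k, ∇f⟩ = 0` with `f(·, t) = ψ`, and `φ` is a cutoff equal to 1 for `|x| ≤ N` and to 0
for `|x| ≥ 2N`. Then `∫ ψ dn_t` equals the integral over `[0, t]` of `∫ (φ ⟨b - b_k, ∇f⟩ + f ⟨b,
∇φ⟩) dn_s`. Since `|f| ≤ sup |ψ|` and `∇φ` is `O(1/N)` and lives on `N < |x| < 2N`, the second term
is controlled by (i). The first is controlled by (iii), provided that `|∇f| ≤ const · √V_k` with a
constant independent of `k`. One lets `k → ∞` with `N` fixed, then `N → ∞`; hence the constants in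
(ii) may depend on the ball.

The gradient bound is the heart of the matter (`exists_transport_solution`). If `X` is a
characteristic and `Z` its derivative in the initial point, (ii) bounds the logarithmic derivative
of `|Z|² V_k(X)`, and `inf V_k > 0` turns this into a bound on `|Z|`. As `b_k` lives only on a ball,
it is multiplied by `η²` with a cutoff `η`; the term produced by `∇η` is absorbed by `δ |b_k|²`
(`cutoff_lyapunov_inequality`).

The null set in the equation depends on the test function, while the ideal test function depends on
`t`. So the field is switched off between rational times `q < q'` just after `t`: countably many
test functions suffice, each close to `φ ψ` at time `t` (`exists_test_function`,
`ae_enorm_integral_le`). The rest is measure theory for families of locally bounded signed measures;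
its main tool is that a Jordan part is a supremum over a countable algebra, which gives
measurability of variations in `t` and a common null set for all Borel sets. -/

noncomputable section

/-! ### Flows of vector fields and their differentiability in the initial point -/

section Flow

open scoped NNReal

/-- A trajectory moves by at most `M * S` in time `S`, so Picard–Lindelöf with this radius covers
the whole interval at once, without gluing local solutions. -/
theorem exists_flow_of_lipschitz_of_bounded {G : Type*} [NormedAddCommGroup G] [NormedSpace ℝ G]
    [CompleteSpace G] {A : G → G} {K : ℝ≥0} {M : ℝ} (hA : LipschitzWith K A)
    (hM : ∀ y, ‖A y‖ ≤ M) {S : ℝ} (hS : 0 < S) :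
    ∃ Φ : G → ℝ → G, (∀ y, Φ y 0 = y) ∧
      ∀ y, ∀ σ ∈ Ioo (-S) S, HasDerivAt (Φ y) (A (Φ y σ)) σ := by
  have key : ∀ y : G, ∃ α : ℝ → G, α 0 = y ∧ ∀ σ ∈ Ioo (-S) S, HasDerivAt α (A (α σ)) σ := by
    intro y
    have hM0 : 0 ≤ M := (norm_nonneg _).trans (hM y)
    have h0 : (0 : ℝ) ∈ Icc (-S) S := ⟨by linarith, hS.le⟩
    have hPL : IsPicardLindelof (fun _ => A) (⟨0, h0⟩ : Icc (-S) S) y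
        (M.toNNReal * S.toNNReal) 0 M.toNNReal K :=
      { lipschitzOnWith := fun _ _ => hA.lipschitzOnWith
        continuousOn := fun _ _ => continuousOn_const
        norm_le := fun _ _ x _ => by rw [Real.coe_toNNReal _ hM0]; exact hM x
        mul_max_le := by simp [hS.le] }
    obtain ⟨α, h1, h2⟩ := hPL.exists_eq_forall_mem_Icc_hasDerivWithinAt₀
    exact ⟨α, h1, fun σ hσ => (h2 σ (Ioo_subset_Icc_self hσ)).hasDerivAt
      (Icc_mem_nhds hσ.1 hσ.2)⟩
  choose Φ h1 h2 using key
  exact ⟨Φ, h1, h2⟩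

theorem continuousOn_Icc_of_hasDerivAt_Ico {G : Type*} [NormedAddCommGroup G] [NormedSpace ℝ G]
    {α α' : ℝ → G} {S s : ℝ} (h : ∀ σ ∈ Ico 0 S, HasDerivAt α (α' σ) σ) (hs : s < S) :
    ContinuousOn α (Icc 0 s) := fun σ hσ =>
  (h σ ⟨hσ.1, hσ.2.trans_lt hs⟩).continuousAt.continuousWithinAt

theorem dist_flow_le {G : Type*} [NormedAddCommGroup G] [NormedSpace ℝ G]
    {A : G → G} {K : ℝ≥0} (hA : LipschitzWith K A) {S : ℝ} {Φ : G → ℝ → G}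
    (h0 : ∀ y, Φ y 0 = y) (h : ∀ y, ∀ σ ∈ Ico 0 S, HasDerivAt (Φ y) (A (Φ y σ)) σ)
    (y z : G) {σ : ℝ} (hσ : σ ∈ Ico 0 S) :
    dist (Φ y σ) (Φ z σ) ≤ dist y z * Real.exp (K * S) := by
  have := dist_le_of_trajectories_ODE (v := fun _ => A) (K := K) (a := 0) (b := σ) (f := Φ y)
    (g := Φ z) (δ := dist y z) (fun _ => hA)
    (continuousOn_Icc_of_hasDerivAt_Ico (h y) hσ.2)
    (fun t ht => (h y t ⟨ht.1, ht.2.trans hσ.2⟩).hasDerivWithinAt)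
    (continuousOn_Icc_of_hasDerivAt_Ico (h z) hσ.2)
    (fun t ht => (h z t ⟨ht.1, ht.2.trans hσ.2⟩).hasDerivWithinAt) (by simp [h0])
    σ ⟨hσ.1, le_rfl⟩
  refine this.trans ?_
  have h2 : σ ≤ S := hσ.2.le
  gcongr
  simpa using h2

theorem continuousOn_flow {G : Type*} [NormedAddCommGroup G] [NormedSpace ℝ G]
    {A : G → G} {K : ℝ≥0} (hA : LipschitzWith K A) {S : ℝ} {Φ : G → ℝ → G}
    (h0 : ∀ y, Φ y 0 = y) (h : ∀ y, ∀ σ ∈ Ico 0 S, HasDerivAt (Φ y) (A (Φ y σ)) σ) :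
    ContinuousOn (fun p : G × ℝ => Φ p.1 p.2) (univ ×ˢ Ico 0 S) := by
  refine continuousOn_prod_of_continuousOn_lipschitzOnWith (fun p : G × ℝ => Φ p.1 p.2)
    (Real.exp (K * S)).toNNReal ?_ ?_
  · intro y _ σ hσ
    exact (h y σ hσ).continuousAt.continuousWithinAt
  · intro σ hσ
    refine LipschitzWith.lipschitzOnWith (LipschitzWith.of_dist_le_mul fun y z => ?_)
    rw [Real.coe_toNNReal _ (Real.exp_pos _).le, mul_comm]
    exact dist_flow_le hA h0 h y z hσ

/-- Serves to make the linearised flow equation, which is linear and hence unbounded in the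
derivative variable, globally bounded and Lipschitz. -/
theorem exists_lipschitz_truncation {G : Type*} [NormedAddCommGroup G] [NormedSpace ℝ G]
    [FiniteDimensional ℝ G] (R : ℝ) :
    ∃ (P : G → G) (K : ℝ≥0) (C : ℝ), LipschitzWith K P ∧ (∀ w, ‖P w‖ ≤ C) ∧
      (∀ w, ‖P w‖ ≤ ‖w‖) ∧ ∀ w, ‖w‖ ≤ R → P w = w := by
  let f : ContDiffBump (0 : G) := ⟨max R 1, max R 1 + 1, by positivity, by linarith⟩
  let P : G → G := fun w => f w • w
  have hc : ContDiff ℝ 1 P := f.contDiff.smul contDiff_id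
  have hs : HasCompactSupport P := f.hasCompactSupport.smul_right
  obtain ⟨C, hC⟩ := hs.exists_bound_of_continuous hc.continuous
  obtain ⟨K, hK⟩ := hc.lipschitzWith_of_hasCompactSupport hs one_ne_zero
  refine ⟨P, K, C, hK, hC, fun w => ?_, fun w hw => ?_⟩
  · simp only [P, norm_smul, Real.norm_eq_abs, abs_of_nonneg f.nonneg]
    exact mul_le_of_le_one_left (norm_nonneg _) f.le_one
  · simp only [P]
    rw [f.one_of_mem_closedBall, one_smul]
    simpa [f] using Or.inl hw

theorem norm_sub_sub_le_of_lipschitz_fderiv {F : Type*} [NormedAddCommGroup F] [NormedSpace ℝ F]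
    {A : F → F} {A' : F → F →L[ℝ] F} {K : ℝ≥0} (hA : ∀ y, HasFDerivAt A (A' y) y)
    (hA' : LipschitzWith K A') (y z : F) :
    ‖A z - A y - A' y (z - y)‖ ≤ K * ‖z - y‖ ^ 2 := by
  have h := Convex.norm_image_sub_le_of_norm_hasFDerivWithin_le' (f := A) (f' := A') (φ := A' y)
    (s := Metric.closedBall y ‖z - y‖) (C := K * ‖z - y‖) (x := y) (y := z)
    (fun x _ => (hA x).hasFDerivWithinAt) (fun x hx => ?_) (convex_closedBall _ _)
    (by simp) (by simp [dist_eq_norm])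
  · rw [pow_two, ← mul_assoc]; exact h
  · rw [← dist_eq_norm]
    exact (hA'.dist_le_mul x y).trans (by gcongr; exact hx)

/-- The flow of a bounded vector field with bounded and Lipschitz derivative, together with its
derivative with respect to the initial point. -/
theorem exists_differentiable_flow {F : Type*} [NormedAddCommGroup F] [NormedSpace ℝ F]
    [FiniteDimensional ℝ F] {A : F → F} {A' : F → F →L[ℝ] F} {K₁ K₂ : ℝ≥0} {M : ℝ}
    (hA : ∀ y, HasFDerivAt A (A' y) y) (hM : ∀ y, ‖A y‖ ≤ M) (hK₁ : ∀ y, ‖A' y‖ ≤ K₁)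
    (hK₂ : LipschitzWith K₂ A') {S : ℝ} (hS : 0 < S) :
    ∃ (Φ : F → ℝ → F) (J : F → ℝ → F →L[ℝ] F),
      (∀ y, Φ y 0 = y) ∧ (∀ y, J y 0 = ContinuousLinearMap.id ℝ F) ∧
      (∀ y, ∀ σ ∈ Ico 0 S, HasDerivAt (Φ y) (A (Φ y σ)) σ) ∧
      (∀ y, ∀ σ ∈ Ico 0 S, HasDerivAt (J y) ((A' (Φ y σ)).comp (J y σ)) σ) ∧
      ContinuousOn (fun p : F × ℝ => Φ p.1 p.2) (univ ×ˢ Ico 0 S) ∧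
      ContinuousOn (fun p : F × ℝ => J p.1 p.2) (univ ×ˢ Ico 0 S) ∧
      ∀ σ ∈ Ico 0 S, ∀ y, HasFDerivAt (fun z => Φ z σ) (J y σ) y := by
  have hLip : LipschitzWith K₁ A := lipschitzWith_of_nnnorm_fderiv_le
    (fun y => (hA y).differentiableAt) (fun y => by rw [(hA y).fderiv]; exact hK₁ y)
  obtain ⟨P, KP, CP, hPL, hPC, hPn, hPe⟩ :=
    exists_lipschitz_truncation (G := F →L[ℝ] F) (Real.exp (K₁ * S))
  have hCP : 0 ≤ CP := (norm_nonneg _).trans (hPC 0)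
  -- The flow and its linearisation are solved as one autonomous system, with the derivative
  -- variable truncated by `P`.
  let B : F × (F →L[ℝ] F) → F × (F →L[ℝ] F) := fun p => (A p.1, (A' p.1).comp (P p.2))
  have hBL : LipschitzWith (K₁ + (K₂ * CP.toNNReal + K₁ * KP)) B := by
    refine LipschitzWith.of_dist_le_mul fun p q => ?_
    have e1 : dist p.1 q.1 ≤ dist p q := le_max_left _ _
    have e2 : dist p.2 q.2 ≤ dist p q := le_max_right _ _
    refine max_le ?_ ?_
    · refine (hLip.dist_le_mul p.1 q.1).trans ?_
      push_cast
      gcongr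
      exact le_add_of_nonneg_right (by positivity)
    · simp only [B]
      have h3 : (A' p.1).comp (P p.2) - (A' q.1).comp (P q.2)
          = (A' p.1 - A' q.1).comp (P p.2) + (A' q.1).comp (P p.2 - P q.2) := by
        ext v; simp
      rw [dist_eq_norm, h3]
      have h4 : ‖A' p.1 - A' q.1‖ ≤ K₂ * dist p q := by
        rw [← dist_eq_norm]; exact (hK₂.dist_le_mul _ _).trans (by gcongr)
      have h5 : ‖P p.2 - P q.2‖ ≤ KP * dist p q := by
        rw [← dist_eq_norm]; exact (hPL.dist_le_mul _ _).trans (by gcongr)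
      calc _ ≤ ‖A' p.1 - A' q.1‖ * ‖P p.2‖ + ‖A' q.1‖ * ‖P p.2 - P q.2‖ :=
            (norm_add_le _ _).trans (add_le_add (ContinuousLinearMap.opNorm_comp_le _ _)
              (ContinuousLinearMap.opNorm_comp_le _ _))
        _ ≤ (K₂ * dist p q) * CP + K₁ * (KP * dist p q) := by
            gcongr
            · exact hPC _
            · exact hK₁ _
        _ ≤ _ := by
            push_cast
            rw [Real.coe_toNNReal _ hCP]
            have : 0 ≤ K₁ * dist p q := by positivity
            linarith
  have hBM : ∀ p, ‖B p‖ ≤ max M (K₁ * CP) := fun p => max_le_max (hM _)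
    ((ContinuousLinearMap.opNorm_comp_le _ _).trans
      (mul_le_mul (hK₁ _) (hPC _) (norm_nonneg _) (by positivity)))
  obtain ⟨Ψ, hΨ0, hΨ⟩ := exists_flow_of_lipschitz_of_bounded hBL hBM hS
  have hΨ' : ∀ y, ∀ σ ∈ Ico 0 S, HasDerivAt (Ψ y) (B (Ψ y σ)) σ :=
    fun y σ hσ => hΨ y σ ⟨by linarith [hσ.1], hσ.2⟩
  have hΨc := continuousOn_flow hBL hΨ0 hΨ'
  let Φ : F → ℝ → F := fun y σ => (Ψ (y, ContinuousLinearMap.id ℝ F) σ).1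
  let J : F → ℝ → F →L[ℝ] F := fun y σ => (Ψ (y, ContinuousLinearMap.id ℝ F) σ).2
  have hΦ0 : ∀ y, Φ y 0 = y := fun y => by simp [Φ, hΨ0]
  have hJ0 : ∀ y, J y 0 = ContinuousLinearMap.id ℝ F := fun y => by simp [J, hΨ0]
  have hΦ : ∀ y, ∀ σ ∈ Ico 0 S, HasDerivAt (Φ y) (A (Φ y σ)) σ := fun y σ hσ =>
    (hasFDerivAt_fst.comp_hasDerivAt σ (hΨ' (y, ContinuousLinearMap.id ℝ F) σ hσ) :)
  have hJP : ∀ y, ∀ σ ∈ Ico 0 S, HasDerivAt (J y) ((A' (Φ y σ)).comp (P (J y σ))) σ :=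
    fun y σ hσ =>
      (hasFDerivAt_snd.comp_hasDerivAt σ (hΨ' (y, ContinuousLinearMap.id ℝ F) σ hσ) :)
  -- Gronwall needs only `‖P w‖ ≤ ‖w‖`, and the resulting bound is the radius within which `P` is
  -- the identity. So the truncation is never active.
  have hJn : ∀ y, ∀ σ ∈ Ico 0 S, ‖J y σ‖ ≤ Real.exp (K₁ * S) := by
    intro y σ hσ
    have := norm_le_gronwallBound_of_norm_deriv_right_le (f := J y) (δ := 1) (K := K₁) (ε := 0)
      (a := 0) (b := σ) (continuousOn_Icc_of_hasDerivAt_Ico (hJP y) hσ.2)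
      (fun t ht => (hJP y t ⟨ht.1, ht.2.trans hσ.2⟩).hasDerivWithinAt)
      (by rw [hJ0]; exact ContinuousLinearMap.norm_id_le)
      (fun t ht => by
        rw [add_zero]
        exact (ContinuousLinearMap.opNorm_comp_le _ _).trans
          (mul_le_mul (hK₁ _) (hPn _) (norm_nonneg _) (by positivity)))
      σ ⟨hσ.1, le_rfl⟩
    rw [gronwallBound_ε0, one_mul] at this
    refine this.trans ?_
    have h2 : σ ≤ S := hσ.2.le
    gcongr
    simpa using h2
  have hJ : ∀ y, ∀ σ ∈ Ico 0 S, HasDerivAt (J y) ((A' (Φ y σ)).comp (J y σ)) σ := by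
    intro y σ hσ
    have := hJP y σ hσ
    rwa [hPe _ (hJn y σ hσ)] at this
  have hemb : ContinuousOn (fun p : F × ℝ => Ψ (p.1, ContinuousLinearMap.id ℝ F) p.2)
      (univ ×ˢ Ico 0 S) :=
    hΨc.comp (f := fun p : F × ℝ => ((p.1, ContinuousLinearMap.id ℝ F), p.2))
      (by fun_prop) (fun p hp => ⟨trivial, hp.2⟩)
  refine ⟨Φ, J, hΦ0, hJ0, hΦ, hJ, continuous_fst.comp_continuousOn hemb,
    continuous_snd.comp_continuousOn hemb, fun σ hσ y => ?_⟩
  have hΦd : ∀ z, ∀ τ ∈ Ico 0 S, ‖Φ z τ - Φ y τ‖ ≤ ‖z - y‖ * Real.exp (K₁ * S) := by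
    intro z τ hτ
    simpa [dist_eq_norm] using dist_flow_le hLip hΦ0 hΦ z y hτ
  set C : ℝ := gronwallBound 0 K₁ (K₂ * Real.exp (K₁ * S) ^ 2) σ with hC
  -- The remainder starts at 0 and solves the linearised equation up to a Taylor error of order `‖z
  -- - y‖ ^ 2`; Gronwall keeps it of that order.
  have hrem : ∀ z, ‖Φ z σ - Φ y σ - J y σ (z - y)‖ ≤ C * ‖z - y‖ ^ 2 := by
    intro z
    have hd : ∀ τ ∈ Ico 0 S, HasDerivAt (fun τ => Φ z τ - Φ y τ - J y τ (z - y))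
        (A (Φ z τ) - A (Φ y τ) - (A' (Φ y τ)) (J y τ (z - y))) τ := fun τ hτ =>
      ((hΦ z τ hτ).sub (hΦ y τ hτ)).sub
        (((ContinuousLinearMap.apply ℝ F (z - y)).hasFDerivAt.comp_hasDerivAt τ (hJ y τ hτ) :))
    have := norm_le_gronwallBound_of_norm_deriv_right_le
      (f := fun τ => Φ z τ - Φ y τ - J y τ (z - y)) (δ := 0) (K := K₁)
      (ε := K₂ * Real.exp (K₁ * S) ^ 2 * ‖z - y‖ ^ 2)
      (a := 0) (b := σ) (continuousOn_Icc_of_hasDerivAt_Ico hd hσ.2)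
      (fun t ht => (hd t ⟨ht.1, ht.2.trans hσ.2⟩).hasDerivWithinAt)
      (by simp [hΦ0, hJ0])
      (fun t ht => by
        have ht' : t ∈ Ico 0 S := ⟨ht.1, ht.2.trans hσ.2⟩
        have e : A (Φ z t) - A (Φ y t) - (A' (Φ y t)) (J y t (z - y))
            = A' (Φ y t) (Φ z t - Φ y t - J y t (z - y))
              + (A (Φ z t) - A (Φ y t) - A' (Φ y t) (Φ z t - Φ y t)) := by
          simp only [map_sub]; abel
        rw [e]
        refine (norm_add_le _ _).trans (add_le_add ?_ ?_)
        · exact (ContinuousLinearMap.le_opNorm _ _).trans (by gcongr; exact hK₁ _)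
        · refine (norm_sub_sub_le_of_lipschitz_fderiv hA hK₂ _ _).trans ?_
          rw [mul_assoc]
          gcongr
          rw [← mul_pow, mul_comm]
          gcongr
          exact hΦd z t ht')
      σ ⟨hσ.1, le_rfl⟩
    refine this.trans (le_of_eq ?_)
    rw [hC, sub_zero]
    unfold gronwallBound
    split_ifs <;> ring
  refine HasFDerivAt.of_isLittleO ?_
  have hO : (fun z => Φ z σ - Φ y σ - J y σ (z - y)) =O[𝓝 y] fun z => ‖z - y‖ ^ 2 :=
    Asymptotics.IsBigO.of_bound C (Eventually.of_forall fun z => by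
      simpa using hrem z)
  refine hO.trans_isLittleO ?_
  have := Asymptotics.isLittleO_pow_id (𝕜 := ℝ) (n := 2) one_lt_two
  have ht : Tendsto (fun z => ‖z - y‖) (𝓝 y) (𝓝 0) := by
    have : Continuous fun z => ‖z - y‖ := by fun_prop
    simpa using this.tendsto y
  exact (this.comp_tendsto ht).trans_isBigO (by
    simpa [Function.comp_def] using (Asymptotics.isBigO_refl (fun z => z - y) (𝓝 y)).norm_left)

/-- The flow transports its own vector field. -/
theorem flow_fderiv_apply_field {F : Type*} [NormedAddCommGroup F] [NormedSpace ℝ F]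
    {A : F → F} {A' : F → F →L[ℝ] F} {K₁ : ℝ≥0}
    (hA : ∀ y, HasFDerivAt A (A' y) y) (hK₁ : ∀ y, ‖A' y‖ ≤ K₁) {S : ℝ} {Φ : ℝ → F}
    {J : ℝ → F →L[ℝ] F} {y : F} (hΦ0 : Φ 0 = y) (hJ0 : J 0 = ContinuousLinearMap.id ℝ F)
    (hΦ : ∀ σ ∈ Ico 0 S, HasDerivAt Φ (A (Φ σ)) σ)
    (hJ : ∀ σ ∈ Ico 0 S, HasDerivAt J ((A' (Φ σ)).comp (J σ)) σ) {σ : ℝ} (hσ : σ ∈ Ico 0 S) :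
    J σ (A y) = A (Φ σ) := by
  -- Both sides solve the same linear equation along the trajectory and agree at time 0.
  have hd : ∀ τ ∈ Ico 0 S, HasDerivAt (fun τ => J τ (A y) - A (Φ τ))
      (A' (Φ τ) (J τ (A y)) - A' (Φ τ) (A (Φ τ))) τ := fun τ hτ =>
    (((ContinuousLinearMap.apply ℝ F (A y)).hasFDerivAt.comp_hasDerivAt τ (hJ τ hτ) :)).sub
      ((hA (Φ τ)).comp_hasDerivAt τ (hΦ τ hτ))
  have := eq_zero_of_abs_deriv_le_mul_abs_self_of_eq_zero_right
    (f := fun τ => J τ (A y) - A (Φ τ)) (K := K₁) (a := 0) (b := σ)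
    (continuousOn_Icc_of_hasDerivAt_Ico hd hσ.2)
    (fun t ht => (hd t ⟨ht.1, ht.2.trans hσ.2⟩).hasDerivWithinAt)
    (by simp [hΦ0, hJ0])
    (fun t ht => by
      rw [← map_sub]
      exact (ContinuousLinearMap.le_opNorm _ _).trans (by gcongr; exact hK₁ _))
    σ ⟨hσ.1, le_rfl⟩
  exact sub_eq_zero.1 this

end Flow

/-! ### The backward transport equation and the weighted gradient bound -/

section Transport

open scoped NNReal

/-- Both partial derivatives, in the initial point and in time, are jointly continuous. -/
theorem contDiffOn_flow {F : Type*} [NormedAddCommGroup F] [NormedSpace ℝ F]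
    {A : F → F} {S : ℝ} {Φ : F → ℝ → F} {J : F → ℝ → F →L[ℝ] F} (hA : Continuous A)
    (hΦ : ∀ y, ∀ σ ∈ Ico 0 S, HasDerivAt (Φ y) (A (Φ y σ)) σ)
    (hΦc : ContinuousOn (fun p : F × ℝ => Φ p.1 p.2) (univ ×ˢ Ico 0 S))
    (hJc : ContinuousOn (fun p : F × ℝ => J p.1 p.2) (univ ×ˢ Ico 0 S))
    (hJ : ∀ σ ∈ Ico 0 S, ∀ y, HasFDerivAt (fun z => Φ z σ) (J y σ) y) :
    ContDiffOn ℝ 1 (fun p : F × ℝ => Φ p.1 p.2) (univ ×ˢ Ioo 0 S) ∧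
    ∀ p ∈ (univ : Set F) ×ˢ Ioo 0 S, HasFDerivAt (fun p : F × ℝ => Φ p.1 p.2)
      ((J p.1 p.2).coprod (ContinuousLinearMap.toSpanSingleton ℝ (A (Φ p.1 p.2)))) p := by
  have hopen : IsOpen ((univ : Set F) ×ˢ Ioo 0 S) := isOpen_univ.prod isOpen_Ioo
  have hsub : (univ : Set F) ×ˢ Ioo 0 S ⊆ univ ×ˢ Ico 0 S := prod_mono le_rfl Ioo_subset_Ico_self
  have hf₂ : ContinuousOn
      (fun p : F × ℝ => ContinuousLinearMap.toSpanSingleton ℝ (A (Φ p.1 p.2)))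
      (univ ×ˢ Ioo 0 S) := by
    have : Continuous fun z : F => ContinuousLinearMap.toSpanSingleton ℝ z :=
      (ContinuousLinearMap.toSpanSingletonCLE (𝕜 := ℝ) (E := F)).continuous
    exact (this.comp hA).comp_continuousOn (hΦc.mono hsub)
  have hfd : ∀ p ∈ (univ : Set F) ×ˢ Ioo 0 S, HasFDerivAt (fun p : F × ℝ => Φ p.1 p.2)
      ((J p.1 p.2).coprod (ContinuousLinearMap.toSpanSingleton ℝ (A (Φ p.1 p.2)))) p := by
    intro p hp
    refine (hasStrictFDerivAt_uncurry_coprod (f := Φ) (f₁ := J)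
      (f₂ := fun y σ => ContinuousLinearMap.toSpanSingleton ℝ (A (Φ y σ))) ?_ ?_
      (hJc.continuousAt (mem_of_superset (hopen.mem_nhds hp) hsub))
      (hf₂.continuousAt (hopen.mem_nhds hp))).hasFDerivAt
    · filter_upwards [hopen.mem_nhds hp] with q hq using hJ q.2 (hsub hq).2 q.1
    · filter_upwards [hopen.mem_nhds hp] with q hq
      exact (hΦ q.1 q.2 (hsub hq).2).hasFDerivAt
  refine ⟨?_, hfd⟩
  rw [show (1 : WithTop ℕ∞) = 0 + 1 by simp, contDiffOn_succ_iff_fderiv_of_isOpen hopen]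
  refine ⟨fun p hp => (hfd p hp).differentiableAt.differentiableWithinAt, by simp, ?_⟩
  rw [contDiffOn_zero]
  have hc : ContinuousOn (fun p : F × ℝ => (J p.1 p.2).coprod
      (ContinuousLinearMap.toSpanSingleton ℝ (A (Φ p.1 p.2)))) (univ ×ˢ Ioo 0 S) := by
    exact (ContinuousLinearMap.coprodEquivL (𝕜 := ℝ) (S := ℝ) (E := F) (F := ℝ)
      (G := F)).continuous.comp_continuousOn ((hJc.mono hsub).prodMk hf₂)
  exact hc.congr fun p hp => (hfd p hp).fderiv

theorem exists_lipschitzWith_fderiv_of_hasCompactSupport {F G : Type*} [NormedAddCommGroup F]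
    [NormedSpace ℝ F] [NormedAddCommGroup G] [NormedSpace ℝ G] {a : F → G} (ha : ContDiff ℝ 2 a)
    (hc : HasCompactSupport a) : ∃ K, LipschitzWith K (fderiv ℝ a) := by
  have hs := hc.fderiv (𝕜 := ℝ)
  have hfa : ContDiff ℝ 1 (fderiv ℝ a) := ha.fderiv_right (by norm_num [one_add_one_eq_two])
  exact hfa.lipschitzWith_of_hasCompactSupport hs one_ne_zero

theorem le_exp_mul_of_deriv_right_le {ρ ρ' : ℝ → ℝ} {Γ σ : ℝ} (hσ : 0 ≤ σ)
    (hρ : ContinuousOn ρ (Icc 0 σ)) (hd : ∀ τ ∈ Ico 0 σ, HasDerivAt ρ (ρ' τ) τ)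
    (hb : ∀ τ ∈ Ico 0 σ, ρ' τ ≤ Γ * ρ τ) : ρ σ ≤ ρ 0 * Real.exp (Γ * σ) := by
  have := le_gronwallBound_of_liminf_deriv_right_le (f := ρ) (f' := ρ') (δ := ρ 0) (K := Γ)
    (ε := 0) (a := 0) (b := σ) hρ
    (fun x hx r hr => (hd x hx).hasDerivWithinAt.liminf_right_slope_le hr) le_rfl
    (by simpa using hb) σ ⟨hσ, le_rfl⟩
  rwa [gronwallBound_ε0, sub_zero] at this

/-- The speed is at most `M` before `r`, and there is no motion afterwards. This keeps transported
data close to the terminal data when the field is switched off soon. -/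
theorem norm_sub_le_of_deriv_eq_zero_after {E : Type*} [NormedAddCommGroup E] [NormedSpace ℝ E]
    {X X' : ℝ → E} {S M r : ℝ} (hX : ∀ τ ∈ Ico 0 S, HasDerivAt X (X' τ) τ)
    (hM : ∀ τ, ‖X' τ‖ ≤ M) (hr : ∀ τ, r ≤ τ → X' τ = 0) {σ : ℝ} (hσ : σ ∈ Ico 0 S) :
    ‖X σ - X 0‖ ≤ M * max r 0 := by
  have hM0 : 0 ≤ M := (norm_nonneg _).trans (hM 0)
  have hlip : ∀ τ ∈ Ico 0 S, ‖X τ - X 0‖ ≤ M * τ := by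
    intro τ hτ
    have := norm_image_sub_le_of_norm_deriv_le_segment' (f := X) (f' := X') (a := 0) (b := τ)
      (C := M) (fun t ht => (hX t ⟨ht.1, ht.2.trans_lt hτ.2⟩).hasDerivWithinAt)
      (fun t _ => hM t) τ ⟨hτ.1, le_rfl⟩
    simpa using this
  by_cases h : σ ≤ max r 0
  · exact (hlip σ hσ).trans (by gcongr)
  · push Not at h
    have hm : max r 0 ∈ Ico 0 S := ⟨le_max_right _ _, h.trans hσ.2⟩
    have := norm_image_sub_le_of_norm_deriv_le_segment' (f := X) (f' := X') (a := max r 0) (b := σ)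
      (C := 0) (fun t ht => (hX t ⟨hm.1.trans ht.1, ht.2.trans_lt hσ.2⟩).hasDerivWithinAt)
      (fun t ht => by rw [hr t ((le_max_left _ _).trans ht.1), norm_zero]) σ ⟨h.le, le_rfl⟩
    have e : X σ = X (max r 0) := by
      rw [zero_mul] at this
      exact sub_eq_zero.1 (norm_le_zero_iff.1 this)
    rw [e]
    exact hlip _ hm

/-- The solution, by characteristics, of the backward transport equation with terminal data `ψ`,
with a gradient bound by a Lyapunov-type weight `W`. -/
theorem exists_transport_solution {E : Type*} [NormedAddCommGroup E] [InnerProductSpace ℝ E]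
    [FiniteDimensional ℝ E] {a : E × ℝ → E} (ha : ContDiff ℝ 2 a) (hc : HasCompactSupport a)
    {M : ℝ} (hM : ∀ p, ‖a p‖ ≤ M) {T : ℝ} (hT : 0 < T) {q : ℝ}
    (haq : ∀ x t, q ≤ t → a (x, t) = 0) {ψ : E → ℝ} (hψ : ContDiff ℝ 1 ψ) {L : ℝ}
    (hL : ∀ x, ‖fderiv ℝ ψ x‖ ≤ L) {W : E → ℝ} (hW : ContDiff ℝ 1 W) {c : ℝ} (hc0 : 0 < c)
    (hcW : ∀ x, c ≤ W x) {Γ : ℝ} (hΓ : 0 ≤ Γ)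
    (hineq : ∀ x, ∀ t, 0 ≤ t → ∀ ξ : E, 2 * inner ℝ (fderiv ℝ a (x, t) (ξ, 0)) ξ * W x
      + ‖ξ‖ ^ 2 * fderiv ℝ W x (a (x, t)) ≤ Γ * (‖ξ‖ ^ 2 * W x)) :
    ∃ (f : E × ℝ → ℝ) (Y : E → ℝ → E),
      ContDiffOn ℝ 1 f (univ ×ˢ Ioo (-1) (T + 1)) ∧
      ∀ x, ∀ t ∈ Icc 0 T, f (x, t) = ψ (Y x t) ∧ ‖Y x t - x‖ ≤ M * max (q - t) 0 ∧
        fderiv ℝ f (x, t) (a (x, t), 1) = 0 ∧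
        ∀ v, |fderiv ℝ f (x, t) (v, 0)| ≤
          L * Real.sqrt (Real.exp (Γ * (T + 1)) / c) * Real.sqrt (W x) * ‖v‖ := by
  obtain ⟨K₁, hK₁⟩ := ha.lipschitzWith_of_hasCompactSupport hc two_ne_zero
  obtain ⟨K₂, hK₂⟩ := exists_lipschitzWith_fderiv_of_hasCompactSupport ha hc
  have had : ∀ p, HasFDerivAt a (fderiv ℝ a p) p := fun p =>
    (ha.differentiable two_ne_zero p).hasFDerivAt
  -- Time becomes a coordinate of speed 1, which makes the field autonomous.
  let A : E × ℝ → E × ℝ := fun p => (a p, 1)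
  let A' : E × ℝ → (E × ℝ) →L[ℝ] (E × ℝ) := fun p => (fderiv ℝ a p).prod 0
  have hA : ∀ p, HasFDerivAt A (A' p) p := fun p => (had p).prodMk (hasFDerivAt_const 1 p)
  have hAM : ∀ p, ‖A p‖ ≤ max M 1 := fun p => max_le_max (hM p) (by simp [A])
  have hAK₁ : ∀ p, ‖A' p‖ ≤ K₁ := fun p => by
    rw [ContinuousLinearMap.opNorm_prod]
    exact max_le (norm_fderiv_le_of_lipschitz ℝ hK₁) (by simp)
  have hAK₂ : LipschitzWith K₂ A' := by
    refine LipschitzWith.of_dist_le_mul fun p r => ?_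
    have : A' p - A' r = (fderiv ℝ a p - fderiv ℝ a r).prod 0 := by
      ext <;> simp [A']
    rw [dist_eq_norm, this, ContinuousLinearMap.opNorm_prod]
    refine max_le ?_ (by simp; positivity)
    rw [← dist_eq_norm]
    exact hK₂.dist_le_mul p r
  obtain ⟨Φ, J, hΦ0, hJ0, hΦ, hJ, hΦc, hJc, hΦJ⟩ :=
    exists_differentiable_flow hA hAM hAK₁ hAK₂ (S := T + 2) (by linarith)
  obtain ⟨hΦs, hΦf⟩ := contDiffOn_flow
    (continuous_iff_continuousAt.2 fun p => (hA p).continuousAt) hΦ hΦc hJc hΦJ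
  have hmem : ∀ t, t ∈ Ioo (-1) (T + 1) → T + 1 - t ∈ Ioo 0 (T + 2) := fun t ht =>
    ⟨by linarith [ht.2], by linarith [ht.1]⟩
  -- The datum is read off where the characteristic from `p` stands at time `T + 1`. The margins of
  -- length 1 make `[0, T]` interior to the time interval where `f` is C¹; starting times above `-1`
  -- need a flow of duration `T + 2`.
  let f : E × ℝ → ℝ := fun p => ψ (Φ p (T + 1 - p.2)).1
  have hfs : ContDiffOn ℝ 1 f (univ ×ˢ Ioo (-1) (T + 1)) := by
    refine hψ.comp_contDiffOn (contDiff_fst.comp_contDiffOn ?_)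
    refine hΦs.comp (f := fun p : E × ℝ => (p, T + 1 - p.2)) ?_
      (fun p hp => ⟨trivial, hmem _ hp.2⟩)
    exact (contDiff_id.prodMk (contDiff_const.sub contDiff_snd)).contDiffOn
  refine ⟨f, fun x t => (Φ (x, t) (T + 1 - t)).1, hfs, fun x t ht => ?_⟩
  have ht' : t ∈ Ioo (-1) (T + 1) := ⟨by linarith [ht.1], by linarith [ht.2]⟩
  have hσ := hmem t ht'
  have hσ' : T + 1 - t ∈ Ico 0 (T + 2) := Ioo_subset_Ico_self hσ
  have hX : ∀ τ ∈ Ico 0 (T + 2), HasDerivAt (fun τ => (Φ (x, t) τ).1) (a (Φ (x, t) τ)) τ :=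
    fun τ hτ => (hasFDerivAt_fst.comp_hasDerivAt τ (hΦ (x, t) τ hτ) :)
  have hΦ2 : ∀ τ ∈ Ico 0 (T + 2), (Φ (x, t) τ).2 = t + τ := by
    intro τ hτ
    have hd : ∀ τ ∈ Ico 0 (T + 2), HasDerivAt (fun τ => (Φ (x, t) τ).2 - τ) (1 - 1) τ :=
      fun τ hτ => ((hasFDerivAt_snd.comp_hasDerivAt τ (hΦ (x, t) τ hτ) :)).sub (hasDerivAt_id τ)
    have := constant_of_has_deriv_right_zero (continuousOn_Icc_of_hasDerivAt_Ico hd hτ.2)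
      (fun s hs => by
        simpa using (hd s ⟨hs.1, hs.2.trans hτ.2⟩).hasDerivWithinAt (s := Ici s)) τ ⟨hτ.1, le_rfl⟩
    simp only [hΦ0, sub_zero] at this
    linarith
  have hΦeq : ∀ τ ∈ Ico 0 (T + 2), Φ (x, t) τ = ((Φ (x, t) τ).1, t + τ) :=
    fun τ hτ => Prod.ext rfl (hΦ2 τ hτ)
  have hff : HasFDerivAt f ((fderiv ℝ ψ (Φ (x, t) (T + 1 - t)).1).comp
      ((ContinuousLinearMap.fst ℝ E ℝ).comp
        (((J (x, t) (T + 1 - t)).coprod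
          (ContinuousLinearMap.toSpanSingleton ℝ (A (Φ (x, t) (T + 1 - t))))).comp
          ((ContinuousLinearMap.id ℝ (E × ℝ)).prod (0 - ContinuousLinearMap.snd ℝ E ℝ)))))
      (x, t) := by
    have h1 : HasFDerivAt (fun p : E × ℝ => (p, T + 1 - p.2))
      ((ContinuousLinearMap.id ℝ (E × ℝ)).prod (0 - ContinuousLinearMap.snd ℝ E ℝ)) (x, t) :=
      (hasFDerivAt_id _).prodMk ((hasFDerivAt_const _ _).sub hasFDerivAt_snd)
    have h2 := (hΦf ((x, t), T + 1 - t) ⟨trivial, hσ⟩).comp (x, t) h1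
    have h3 := (hasFDerivAt_fst (𝕜 := ℝ) (p := Φ (x, t) (T + 1 - t))).comp (x, t) h2
    exact ((hψ.differentiable one_ne_zero _).hasFDerivAt (x := (Φ (x, t) (T + 1 - t)).1)).comp
      (x, t) h3
  have hL0 : 0 ≤ L := (norm_nonneg _).trans (hL 0)
  refine ⟨rfl, ?_, ?_, fun v => ?_⟩
  · -- after time `q` the characteristics stand still
    have := norm_sub_le_of_deriv_eq_zero_after (X := fun τ => (Φ (x, t) τ).1)
      (X' := fun τ => a ((Φ (x, t) τ).1, t + τ)) (S := T + 2) (M := M) (r := q - t)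
      (fun τ hτ => by rw [← hΦeq τ hτ]; exact hX τ hτ) (fun τ => hM _)
      (fun τ hτ => haq _ _ (by linarith)) hσ'
    simpa [hΦ0] using this
  -- In the direction `A (x, t)` the change of the starting point contributes `J (A (x, t))` and the
  -- shorter running time `-A (Φ ...)`; these cancel because the flow transports its own field.
  · rw [hff.fderiv]
    have := flow_fderiv_apply_field hA hAK₁ (hΦ0 (x, t)) (hJ0 (x, t)) (hΦ (x, t)) (hJ (x, t)) hσ'
    have e : ((a (x, t), 1) : E × ℝ) = A (x, t) := rfl
    simp [e, this]
    simp [A]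
  · set Z : ℝ → E := fun τ => (J (x, t) τ (v, 0)).1 with hZ
    set X : ℝ → E := fun τ => (Φ (x, t) τ).1 with hXdef
    have hw : ∀ τ ∈ Ico 0 (T + 2), HasDerivAt (fun τ => J (x, t) τ (v, 0))
        (A' (Φ (x, t) τ) (J (x, t) τ (v, 0))) τ := fun τ hτ =>
      ((ContinuousLinearMap.apply ℝ (E × ℝ) ((v, 0) : E × ℝ)).hasFDerivAt.comp_hasDerivAt τ
        (hJ (x, t) τ hτ) :)
    have hw2 : ∀ τ ∈ Ico 0 (T + 2), (J (x, t) τ (v, 0)).2 = 0 := by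
      intro τ hτ
      have hd : ∀ τ ∈ Ico 0 (T + 2), HasDerivAt (fun τ => (J (x, t) τ (v, 0)).2) 0 τ :=
        fun τ hτ => (hasFDerivAt_snd.comp_hasDerivAt τ (hw τ hτ) :)
      have := constant_of_has_deriv_right_zero (continuousOn_Icc_of_hasDerivAt_Ico hd hτ.2)
        (fun s hs => (hd s ⟨hs.1, hs.2.trans hτ.2⟩).hasDerivWithinAt (s := Ici s)) τ ⟨hτ.1, le_rfl⟩
      simpa [hJ0] using this
    have hZd : ∀ τ ∈ Ico 0 (T + 2), HasDerivAt Z (fderiv ℝ a (X τ, t + τ) (Z τ, 0)) τ := by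
      intro τ hτ
      have h1 : HasDerivAt Z (fderiv ℝ a (Φ (x, t) τ) (J (x, t) τ (v, 0))) τ :=
        (hasFDerivAt_fst.comp_hasDerivAt τ (hw τ hτ) :)
      have h2 : J (x, t) τ (v, 0) = (Z τ, 0) := Prod.ext rfl (hw2 τ hτ)
      rw [hΦeq τ hτ, h2] at h1
      exact h1
    have hXd : ∀ τ ∈ Ico 0 (T + 2), HasDerivAt X (a (X τ, t + τ)) τ := fun τ hτ => by
      have := hX τ hτ
      rw [hΦeq τ hτ] at this
      exact this
    -- `Z` is the variation of the characteristic `X` in the direction `v`, and `‖Z‖ ^ 2 * W (X)` is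
    -- the Lyapunov function: `hineq` says that its derivative is at most `Γ` times itself. The
    -- lower bound `c` on `W` at the end point then bounds `‖Z‖`.
    have hρ : ∀ τ ∈ Ico 0 (T + 2), HasDerivAt (fun τ => ‖Z τ‖ ^ 2 * W (X τ))
        (2 * inner ℝ (Z τ) (fderiv ℝ a (X τ, t + τ) (Z τ, 0)) * W (X τ)
          + ‖Z τ‖ ^ 2 * fderiv ℝ W (X τ) (a (X τ, t + τ))) τ := fun τ hτ =>
      (hZd τ hτ).norm_sq.mul
        (((hW.differentiable one_ne_zero (X τ)).hasFDerivAt).comp_hasDerivAt τ (hXd τ hτ))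
    have hest := le_exp_mul_of_deriv_right_le (Γ := Γ) hσ'.1
      (continuousOn_Icc_of_hasDerivAt_Ico hρ hσ'.2)
      (fun τ hτ => hρ τ ⟨hτ.1, hτ.2.trans hσ'.2⟩)
      (fun τ hτ => by
        rw [real_inner_comm]
        exact hineq (X τ) (t + τ) (by linarith [ht.1, hτ.1]) (Z τ))
    have hZ0 : Z 0 = v := by simp [hZ, hJ0]
    have hX0 : X 0 = x := by simp [hXdef, hΦ0]
    simp only [hZ0, hX0] at hest
    have hWx : 0 < W x := hc0.trans_le (hcW x)
    have hexp : Real.exp (Γ * (T + 1 - t)) ≤ Real.exp (Γ * (T + 1)) := by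
      gcongr; linarith [ht.1]
    have hZb : ‖Z (T + 1 - t)‖ ≤
        Real.sqrt (Real.exp (Γ * (T + 1)) / c) * Real.sqrt (W x) * ‖v‖ := by
      refine abs_le_of_sq_le_sq' ?_ (by positivity) |>.2
      rw [mul_pow, mul_pow, Real.sq_sqrt (by positivity), Real.sq_sqrt hWx.le, div_mul_eq_mul_div,
        div_mul_eq_mul_div, le_div_iff₀ hc0]
      calc ‖Z (T + 1 - t)‖ ^ 2 * c ≤ ‖Z (T + 1 - t)‖ ^ 2 * W (X (T + 1 - t)) := by
            gcongr; exact hcW _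
        _ ≤ _ := hest
        _ ≤ ‖v‖ ^ 2 * W x * Real.exp (Γ * (T + 1)) := by gcongr
        _ = _ := by ring
    rw [hff.fderiv]
    have e : (fderiv ℝ ψ (X (T + 1 - t))) (Z (T + 1 - t)) =
      ((fderiv ℝ ψ (Φ (x, t) (T + 1 - t)).1).comp
      ((ContinuousLinearMap.fst ℝ E ℝ).comp
        (((J (x, t) (T + 1 - t)).coprod
          (ContinuousLinearMap.toSpanSingleton ℝ (A (Φ (x, t) (T + 1 - t))))).comp
          ((ContinuousLinearMap.id ℝ (E × ℝ)).prod (0 - ContinuousLinearMap.snd ℝ E ℝ)))))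
        (v, 0) := by
      simp [hZ, hXdef]
    rw [← e, ← Real.norm_eq_abs]
    refine (ContinuousLinearMap.le_opNorm _ _).trans ?_
    rw [mul_assoc L, mul_assoc L]
    gcongr
    exact hL _

end Transport

/-! ### Jordan parts of finite signed measures -/

section SignedMeasure

variable {α : Type*} [MeasurableSpace α]

theorem signedMeasure_exists_hahn (s : SignedMeasure α) :
    ∃ P, MeasurableSet P ∧ ∀ B, MeasurableSet B → 0 ≤ s (P ∩ B) ∧ s (Pᶜ ∩ B) ≤ 0 ∧
      s.toJordanDecomposition.posPart B = ENNReal.ofReal (s (P ∩ B)) ∧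
      s.toJordanDecomposition.negPart B = ENNReal.ofReal (-s (Pᶜ ∩ B)) := by
  obtain ⟨P, h1, h2, h3, h4, h5⟩ := s.toJordanDecomposition_spec
  refine ⟨P, h1, fun B hB => ?_⟩
  have hp : 0 ≤ s (P ∩ B) :=
    s.nonneg_of_zero_le_restrict (s.zero_le_restrict_subset h1 inter_subset_left h2)
  have hn : s (Pᶜ ∩ B) ≤ 0 :=
    s.nonpos_of_restrict_le_zero (s.restrict_le_zero_subset h1.compl inter_subset_left h3)
  refine ⟨hp, hn, ?_, ?_⟩
  · rw [h4, SignedMeasure.toMeasureOfZeroLE_apply _ h2 h1 hB, ENNReal.ofReal, ENNReal.coe_inj]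
    exact (Real.toNNReal_of_nonneg hp).symm
  · rw [h5, SignedMeasure.toMeasureOfLEZero_apply _ h3 h1.compl hB, ENNReal.ofReal,
      ENNReal.coe_inj]
    exact (Real.toNNReal_of_nonneg (neg_nonneg.2 hn)).symm

theorem signedMeasure_apply_eq_sub (s : SignedMeasure α) {B : Set α} (hB : MeasurableSet B) :
    s B = s.toJordanDecomposition.posPart.real B - s.toJordanDecomposition.negPart.real B := by
  conv_lhs => rw [← s.toSignedMeasure_toJordanDecomposition]
  rw [JordanDecomposition.toSignedMeasure, Measure.toSignedMeasure_sub_apply hB]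

/-- Minimality of the Jordan decomposition, seen by evaluating on a Hahn set of the difference. -/
theorem signedMeasure_posPart_sub_le (s₁ s₂ : SignedMeasure α) :
    (s₁ - s₂).toJordanDecomposition.posPart ≤
      s₁.toJordanDecomposition.posPart + s₂.toJordanDecomposition.negPart := by
  refine Measure.le_iff.2 fun B hB => ?_
  obtain ⟨P, hP, h⟩ := signedMeasure_exists_hahn (s₁ - s₂)
  rw [(h B hB).2.2.1, Measure.add_apply]
  refine ENNReal.ofReal_le_of_le_toReal ?_
  rw [ENNReal.toReal_add (measure_ne_top _ _) (measure_ne_top _ _), _root_.sub_apply,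
    signedMeasure_apply_eq_sub s₁ (hP.inter hB), signedMeasure_apply_eq_sub s₂ (hP.inter hB)]
  have h1 : s₁.toJordanDecomposition.posPart.real (P ∩ B) ≤
    s₁.toJordanDecomposition.posPart.real B := measureReal_mono inter_subset_right
  have h2 : s₂.toJordanDecomposition.negPart.real (P ∩ B) ≤
    s₂.toJordanDecomposition.negPart.real B := measureReal_mono inter_subset_right
  have h3 : 0 ≤ s₁.toJordanDecomposition.negPart.real (P ∩ B) := measureReal_nonneg
  have h4 : 0 ≤ s₂.toJordanDecomposition.posPart.real (P ∩ B) := measureReal_nonneg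
  simp only [measureReal_def] at *
  linarith

theorem signedMeasure_negPart_eq (s : SignedMeasure α) :
    s.toJordanDecomposition.negPart = (-s).toJordanDecomposition.posPart := by
  rw [SignedMeasure.toJordanDecomposition_neg, JordanDecomposition.neg_posPart]

theorem signedMeasure_negPart_sub_le (s₁ s₂ : SignedMeasure α) :
    (s₁ - s₂).toJordanDecomposition.negPart ≤
      s₂.toJordanDecomposition.posPart + s₁.toJordanDecomposition.negPart := by
  rw [signedMeasure_negPart_eq, neg_sub]
  exact signedMeasure_posPart_sub_le s₂ s₁

theorem signedMeasure_apply_le_posPart (s : SignedMeasure α) {A B : Set α} (hA : MeasurableSet A)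
    (hB : MeasurableSet B) :
    ENNReal.ofReal (s (A ∩ B)) ≤ s.toJordanDecomposition.posPart B := by
  refine (ENNReal.ofReal_le_of_le_toReal (b := s.toJordanDecomposition.posPart (A ∩ B)) ?_).trans
    (measure_mono inter_subset_right)
  rw [signedMeasure_apply_eq_sub s (hA.inter hB), ← measureReal_def]
  have : 0 ≤ s.toJordanDecomposition.negPart.real (A ∩ B) := measureReal_nonneg
  linarith

/-- The positive part of a signed measure is a supremum over a countable algebra. -/
theorem signedMeasure_posPart_eq_iSup {α : Type*} [m : MeasurableSpace α] (s : SignedMeasure α)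
    {𝒜 : Set (Set α)} (h𝒜 : IsSetAlgebra 𝒜) (hgen : m = MeasurableSpace.generateFrom 𝒜)
    {B : Set α} (hB : MeasurableSet B) :
    s.toJordanDecomposition.posPart B = ⨆ A ∈ 𝒜, ENNReal.ofReal (s (A ∩ B)) := by
  have hmeas : ∀ A ∈ 𝒜, MeasurableSet A := fun A hA => by
    rw [hgen]; exact MeasurableSpace.measurableSet_generateFrom hA
  refine le_antisymm ?_ (iSup₂_le fun A hA => signedMeasure_apply_le_posPart s (hmeas A hA) hB)
  obtain ⟨P, hP, h⟩ := signedMeasure_exists_hahn s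
  set μ := s.toJordanDecomposition.posPart + s.toJordanDecomposition.negPart with hμ
  -- The Hahn set `P` may lie outside the algebra, but a member of the algebra differs from it by
  -- arbitrarily little total variation.
  have hdense := Measure.MeasureDense.of_generateFrom_isSetAlgebra_finite (μ := μ) h𝒜 hgen
  refine ENNReal.le_of_forall_pos_le_add fun ε hε _ => ?_
  obtain ⟨A, hA, hAε⟩ := hdense.approx P hP (measure_ne_top _ _) ε (by exact_mod_cast hε)
  have hAm := hmeas A hA
  rw [(h B hB).2.2.1]
  have key : s (P ∩ B) ≤ s (A ∩ B) + ε := by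
    rw [signedMeasure_apply_eq_sub s (hP.inter hB), signedMeasure_apply_eq_sub s (hAm.inter hB)]
    have hle : ∀ (ν : Measure α) [IsFiniteMeasure ν] (C D : Set α),
        ν.real (C ∩ B) ≤ ν.real (D ∩ B) + ν.real (symmDiff P A) ∨
        ¬ (C \ D ⊆ symmDiff P A) := by
      intro ν _ C D
      by_cases hCD : C \ D ⊆ symmDiff P A
      · left
        refine (measureReal_mono (s₂ := (D ∩ B) ∪ symmDiff P A) ?_).trans (measureReal_union_le _ _)
        rintro x ⟨hx1, hx2⟩
        by_cases hxD : x ∈ D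
        · exact Or.inl ⟨hxD, hx2⟩
        · exact Or.inr (hCD ⟨hx1, hxD⟩)
      · exact Or.inr hCD
    have h1 := (hle s.toJordanDecomposition.posPart P A).resolve_right
      (not_not.2 subset_union_left)
    have h2 := (hle s.toJordanDecomposition.negPart A P).resolve_right
      (not_not.2 subset_union_right)
    have h3 : s.toJordanDecomposition.posPart.real (symmDiff P A)
        + s.toJordanDecomposition.negPart.real (symmDiff P A) ≤ ε := by
      rw [measureReal_def, measureReal_def, ← ENNReal.toReal_add (measure_ne_top _ _)
        (measure_ne_top _ _), ← Measure.add_apply]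
      refine ENNReal.toReal_le_of_le_ofReal hε.le ?_
      have := hAε.le
      rw [hμ] at this
      rwa [ENNReal.ofReal_coe_nnreal] at this ⊢
    linarith
  refine (ENNReal.ofReal_le_ofReal key).trans (ENNReal.ofReal_add_le.trans ?_)
  rw [ENNReal.ofReal_coe_nnreal]
  gcongr
  exact le_iSup₂ (f := fun A (_ : A ∈ 𝒜) => ENNReal.ofReal (s (A ∩ B))) A hA

end SignedMeasure

/-! ### Jordan parts and integrals of locally bounded measures -/

namespace LocBddMeasure

section General

variable {X : Type*} [PseudoMetricSpace X] [MeasurableSpace X]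

theorem ext_of_apply {m n : LocBddMeasure X}
    (h : ∀ A, MeasurableSet A → Bornology.IsBounded A → m A = n A) : m = n := by
  have hf : m.toFun = n.toFun := by
    funext A
    by_cases hA : MeasurableSet A ∧ Bornology.IsBounded A
    · exact h A hA.1 hA.2
    · rw [m.junk' A hA, n.junk' A hA]
  cases m; cases n; congr

theorem sub_apply (m n : LocBddMeasure X) (A : Set X) : (m - n) A = m A - n A := rfl

instance : Zero (LocBddMeasure X) where
  zero :=
    { toFun := fun _ => 0
      junk' := fun _ _ => rfl
      hasSum' := fun _ _ _ _ _ _ => hasSum_zero }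

theorem zero_apply (A : Set X) : (0 : LocBddMeasure X) A = 0 := rfl

theorem restr_apply [ProperSpace X] (m : LocBddMeasure X) {S : Set X} (hS : MeasurableSet S)
    (hb : Bornology.IsBounded S) {A : Set X} (hA : MeasurableSet A) :
    m.restr S hS hb A = m (A ∩ S) := if_pos hA

theorem restr_sub [ProperSpace X] (m n : LocBddMeasure X) {S : Set X} (hS : MeasurableSet S)
    (hb : Bornology.IsBounded S) :
    (m - n).restr S hS hb = m.restr S hS hb - n.restr S hS hb := by
  ext A hA
  rw [_root_.sub_apply, restr_apply _ _ _ hA, restr_apply _ _ _ hA, restr_apply _ _ _ hA,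
    sub_apply]

end General

section Shell

variable {E : Type*} [NormedAddCommGroup E]

theorem pairwise_disjoint_shell : Pairwise fun i j => Disjoint (shell E i) (shell E j) := by
  have key : ∀ i j : ℕ, i < j → Disjoint (shell E i) (shell E j) := by
    intro i j hij
    rw [Set.disjoint_left]
    rintro x ⟨_, h1⟩ ⟨h2, _⟩
    have : (i : ℝ) + 1 ≤ j := by exact_mod_cast hij
    linarith
  intro i j hij
  rcases lt_or_gt_of_ne hij with h | h
  · exact key i j h
  · exact (key j i h).symm

theorem iUnion_shell : ⋃ n, shell E n = univ :=
  eq_univ_of_forall fun x => mem_iUnion.2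
    ⟨⌊‖x‖⌋₊, Nat.floor_le (norm_nonneg _), Nat.lt_floor_add_one _⟩

theorem inter_shell_eq_empty {B : Set E} {J n : ℕ} (hB : B ⊆ Metric.ball 0 J) (hn : J ≤ n) :
    B ∩ shell E n = ∅ := by
  rw [← Set.disjoint_iff_inter_eq_empty, Set.disjoint_left]
  rintro x hx ⟨h, _⟩
  have h1 := hB hx
  rw [mem_ball_zero_iff] at h1
  have : (J : ℝ) ≤ n := by exact_mod_cast hn
  linarith

theorem exists_subset_ball_nat {B : Set E} (hB : Bornology.IsBounded B) :
    ∃ J : ℕ, B ⊆ Metric.ball 0 J := by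
  obtain ⟨r, hr⟩ := hB.subset_ball 0
  obtain ⟨J, hJ⟩ := exists_nat_ge r
  exact ⟨J, hr.trans (Metric.ball_subset_ball hJ)⟩

end Shell

section Normed

variable {E : Type*} [NormedAddCommGroup E] [MeasurableSpace E] [BorelSpace E] [ProperSpace E]

theorem hasSum_inter_shell (m : LocBddMeasure E) {B : Set E} (hB : MeasurableSet B)
    (hb : Bornology.IsBounded B) : HasSum (fun n => m (B ∩ shell E n)) (m B) := by
  have := m.hasSum' (closure B) hb.isCompact_closure (fun n => B ∩ shell E n)
    (fun n => hB.inter (measurableSet_shell n)) (fun n => inter_subset_left.trans subset_closure)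
    (fun i j hij => (pairwise_disjoint_shell hij).mono inter_subset_right inter_subset_right)
  rwa [← inter_iUnion, iUnion_shell, inter_univ] at this

theorem restr_posPart_eq_zero (m : LocBddMeasure E) {B : Set E} (hB : MeasurableSet B) {n : ℕ}
    (h : B ∩ shell E n = ∅) :
    (m.restr (shell E n) (measurableSet_shell n)
      (isBounded_shell n)).toJordanDecomposition.posPart B = 0 ∧
    (m.restr (shell E n) (measurableSet_shell n)
      (isBounded_shell n)).toJordanDecomposition.negPart B = 0 := by
  obtain ⟨P, hP, h'⟩ := signedMeasure_exists_hahn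
    (m.restr (shell E n) (measurableSet_shell n) (isBounded_shell n))
  obtain ⟨-, -, h1, h2⟩ := h' B hB
  rw [h1, h2, restr_apply _ _ _ (hP.inter hB), restr_apply _ _ _ (hP.compl.inter hB),
    inter_assoc, inter_assoc, h, inter_empty, inter_empty, empty_eq_zero]
  simp

theorem posPart_apply_eq_sum (m : LocBddMeasure E) {B : Set E} (hB : MeasurableSet B) {J : ℕ}
    (hJ : B ⊆ Metric.ball 0 J) :
    m.posPart B = ∑ n ∈ Finset.range J, (m.restr (shell E n) (measurableSet_shell n)
      (isBounded_shell n)).toJordanDecomposition.posPart B := by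
  rw [posPart, Measure.sum_apply _ hB]
  refine tsum_eq_sum fun n hn => (restr_posPart_eq_zero m hB (inter_shell_eq_empty hJ ?_)).1
  simpa using hn

theorem negPart_apply_eq_sum (m : LocBddMeasure E) {B : Set E} (hB : MeasurableSet B) {J : ℕ}
    (hJ : B ⊆ Metric.ball 0 J) :
    m.negPart B = ∑ n ∈ Finset.range J, (m.restr (shell E n) (measurableSet_shell n)
      (isBounded_shell n)).toJordanDecomposition.negPart B := by
  rw [negPart, Measure.sum_apply _ hB]
  refine tsum_eq_sum fun n hn => (restr_posPart_eq_zero m hB (inter_shell_eq_empty hJ ?_)).2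
  simpa using hn

theorem posPart_ball_ne_top (m : LocBddMeasure E) (J : ℕ) :
    m.posPart (Metric.ball 0 J) ≠ ⊤ := by
  rw [posPart_apply_eq_sum m Metric.isOpen_ball.measurableSet subset_rfl]
  exact ENNReal.sum_ne_top.2 fun n _ => measure_ne_top _ _

theorem negPart_ball_ne_top (m : LocBddMeasure E) (J : ℕ) :
    m.negPart (Metric.ball 0 J) ≠ ⊤ := by
  rw [negPart_apply_eq_sum m Metric.isOpen_ball.measurableSet subset_rfl]
  exact ENNReal.sum_ne_top.2 fun n _ => measure_ne_top _ _

theorem posPart_ne_top (m : LocBddMeasure E) {B : Set E} (hb : Bornology.IsBounded B) :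
    m.posPart B ≠ ⊤ := by
  obtain ⟨J, hJ⟩ := exists_subset_ball_nat hb
  exact ((measure_mono hJ).trans_lt (posPart_ball_ne_top m J).lt_top).ne

theorem negPart_ne_top (m : LocBddMeasure E) {B : Set E} (hb : Bornology.IsBounded B) :
    m.negPart B ≠ ⊤ := by
  obtain ⟨J, hJ⟩ := exists_subset_ball_nat hb
  exact ((measure_mono hJ).trans_lt (negPart_ball_ne_top m J).lt_top).ne

theorem variation_ne_top (m : LocBddMeasure E) {B : Set E} (hb : Bornology.IsBounded B) :
    m.variation B ≠ ⊤ := by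
  rw [variation, Measure.add_apply]
  exact ENNReal.add_ne_top.2 ⟨posPart_ne_top m hb, negPart_ne_top m hb⟩

/-- A bounded set meets only finitely many shells, so the sums defining the two parts reduce to
finite sums of finite numbers and may be subtracted. -/
theorem apply_eq_sub (m : LocBddMeasure E) {B : Set E} (hB : MeasurableSet B)
    (hb : Bornology.IsBounded B) : m B = m.posPart.real B - m.negPart.real B := by
  obtain ⟨J, hJ⟩ := exists_subset_ball_nat hb
  have h1 : m B = ∑ n ∈ Finset.range J, m (B ∩ shell E n) := by
    refine (hasSum_inter_shell m hB hb).unique (hasSum_sum_of_ne_finset_zero fun n hn => ?_)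
    rw [inter_shell_eq_empty hJ (by simpa using hn), empty_eq_zero]
  rw [h1, measureReal_def, measureReal_def, posPart_apply_eq_sum m hB hJ,
    negPart_apply_eq_sum m hB hJ, ENNReal.toReal_sum fun _ _ => measure_ne_top _ _,
    ENNReal.toReal_sum fun _ _ => measure_ne_top _ _, ← Finset.sum_sub_distrib]
  refine Finset.sum_congr rfl fun n _ => ?_
  rw [← restr_apply m (measurableSet_shell n) (isBounded_shell n) hB,
    signedMeasure_apply_eq_sub _ hB]
  rfl

theorem posPart_sub_le (m₁ m₂ : LocBddMeasure E) :
    (m₁ - m₂).posPart ≤ m₁.posPart + m₂.negPart := by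
  refine Measure.le_iff.2 fun B hB => ?_
  rw [posPart, posPart, negPart, Measure.add_apply, Measure.sum_apply _ hB, Measure.sum_apply _ hB,
    Measure.sum_apply _ hB, ← ENNReal.tsum_add]
  refine ENNReal.tsum_le_tsum fun n => ?_
  rw [restr_sub, ← Measure.add_apply]
  exact signedMeasure_posPart_sub_le _ _ B

theorem negPart_sub_le (m₁ m₂ : LocBddMeasure E) :
    (m₁ - m₂).negPart ≤ m₂.posPart + m₁.negPart := by
  refine Measure.le_iff.2 fun B hB => ?_
  rw [posPart, negPart, negPart, Measure.add_apply, Measure.sum_apply _ hB, Measure.sum_apply _ hB,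
    Measure.sum_apply _ hB, ← ENNReal.tsum_add]
  refine ENNReal.tsum_le_tsum fun n => ?_
  rw [restr_sub, ← Measure.add_apply]
  exact signedMeasure_negPart_sub_le _ _ B

theorem posPart_le_variation (m : LocBddMeasure E) : m.posPart ≤ m.variation :=
  Measure.le_add_right le_rfl

theorem negPart_le_variation (m : LocBddMeasure E) : m.negPart ≤ m.variation :=
  Measure.le_add_left le_rfl

/-- The Jordan parts of a difference are not the differences of the Jordan parts. This identity
between positive measures replaces that and makes `integral` linear in the measure; it is checked on
bounded Borel sets, where all six values are finite. -/
theorem posPart_add_eq (m₁ m₂ : LocBddMeasure E) :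
    (m₁ - m₂).posPart + m₁.negPart + m₂.posPart = (m₁ - m₂).negPart + m₁.posPart + m₂.negPart := by
  refine Measure.ext_of_generateFrom_of_iUnion
    {B : Set E | MeasurableSet B ∧ Bornology.IsBounded B} (fun n : ℕ => Metric.ball 0 n) ?_ ?_ ?_
    (fun n => ⟨Metric.isOpen_ball.measurableSet, Metric.isBounded_ball⟩) (fun n => ?_) ?_
  · refine le_antisymm (fun A hA => ?_) (MeasurableSpace.generateFrom_le fun B hB => hB.1)
    have : A = ⋃ n, A ∩ shell E n := by rw [← inter_iUnion, iUnion_shell, inter_univ]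
    rw [this]
    exact MeasurableSet.iUnion fun n => MeasurableSpace.measurableSet_generateFrom
      ⟨hA.inter (measurableSet_shell n), (isBounded_shell n).subset inter_subset_right⟩
  · exact fun A hA B hB _ => ⟨hA.1.inter hB.1, hA.2.subset inter_subset_left⟩
  · exact Metric.iUnion_ball_nat 0
  · simp only [Measure.add_apply]
    exact ENNReal.add_ne_top.2 ⟨ENNReal.add_ne_top.2 ⟨posPart_ball_ne_top _ _,
      negPart_ball_ne_top _ _⟩, posPart_ball_ne_top _ _⟩
  · rintro B ⟨hB, hb⟩
    have h := sub_apply m₁ m₂ B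
    rw [apply_eq_sub _ hB hb, apply_eq_sub _ hB hb, apply_eq_sub _ hB hb] at h
    simp only [Measure.add_apply]
    have f1 := posPart_ne_top (m₁ - m₂) hb
    have f2 := negPart_ne_top (m₁ - m₂) hb
    have f3 := posPart_ne_top m₁ hb
    have f4 := negPart_ne_top m₁ hb
    have f5 := posPart_ne_top m₂ hb
    have f6 := negPart_ne_top m₂ hb
    rw [← ENNReal.toReal_eq_toReal_iff' (by simp [*]) (by simp [*]), ENNReal.toReal_add (by simp [*])
      f5, ENNReal.toReal_add f1 f4, ENNReal.toReal_add (by simp [*]) f6, ENNReal.toReal_add f2 f3]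
    simp only [measureReal_def] at h
    linarith

theorem integral_sub_apply (m₁ m₂ : LocBddMeasure E) {u : E → ℝ} (h₁ : Integrable u m₁.variation)
    (h₂ : Integrable u m₂.variation) :
    (m₁ - m₂).integral u = m₁.integral u - m₂.integral u := by
  have a1 := h₁.mono_measure m₁.posPart_le_variation
  have a2 := h₁.mono_measure m₁.negPart_le_variation
  have a3 := h₂.mono_measure m₂.posPart_le_variation
  have a4 := h₂.mono_measure m₂.negPart_le_variation
  have a5 : Integrable u (m₁ - m₂).posPart := (a1.add_measure a4).mono_measure (posPart_sub_le _ _)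
  have a6 : Integrable u (m₁ - m₂).negPart := (a3.add_measure a2).mono_measure (negPart_sub_le _ _)
  have h := congrArg (fun μ => ∫ x, u x ∂μ) (posPart_add_eq m₁ m₂)
  beta_reduce at h
  rw [integral_add_measure (a5.add_measure a2) a3, integral_add_measure a5 a2,
    integral_add_measure (a6.add_measure a1) a4, integral_add_measure a6 a1] at h
  simp only [integral]
  linarith

theorem enorm_integral_le (m : LocBddMeasure E) (u : E → ℝ) :
    ‖m.integral u‖ₑ ≤ ∫⁻ x, ‖u x‖ₑ ∂m.variation := by
  rw [integral, variation, lintegral_add_measure]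
  exact enorm_sub_le.trans (add_le_add (enorm_integral_le_lintegral_enorm _)
    (enorm_integral_le_lintegral_enorm _))

theorem integral_indicator_one (m : LocBddMeasure E) {B : Set E} (hB : MeasurableSet B)
    (hb : Bornology.IsBounded B) : m.integral (B.indicator 1) = m B := by
  rw [integral, MeasureTheory.integral_indicator_one hB, MeasureTheory.integral_indicator_one hB,
    apply_eq_sub m hB hb]

end Normed

end LocBddMeasure

/-! ### Measurable families of locally bounded measures -/

section Families

theorem exists_countable_isSetAlgebra (α : Type*) [m : MeasurableSpace α]
    [MeasurableSpace.CountablyGenerated α] :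
    ∃ 𝒜 : Set (Set α), 𝒜.Countable ∧ IsSetAlgebra 𝒜 ∧ m = MeasurableSpace.generateFrom 𝒜 :=
  ⟨generateSetAlgebra (MeasurableSpace.countableGeneratingSet α),
    countable_generateSetAlgebra (MeasurableSpace.countable_countableGeneratingSet),
    isSetAlgebra_generateSetAlgebra, by
      rw [generateFrom_generateSetAlgebra_eq,
        MeasurableSpace.generateFrom_countableGeneratingSet]⟩

theorem signedMeasure_eq_zero_of_algebra {α : Type*} [m : MeasurableSpace α] {s : SignedMeasure α}
    {𝒜 : Set (Set α)} (h𝒜 : IsSetAlgebra 𝒜) (hgen : m = MeasurableSpace.generateFrom 𝒜)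
    (h : ∀ A ∈ 𝒜, s A = 0) {B : Set α} (hB : MeasurableSet B) : s B = 0 := by
  have hp : s.toJordanDecomposition.posPart univ = 0 := by
    rw [signedMeasure_posPart_eq_iSup s h𝒜 hgen MeasurableSet.univ]
    simpa using fun A hA => (h A hA).le
  have hn : s.toJordanDecomposition.negPart univ = 0 := by
    rw [signedMeasure_negPart_eq, signedMeasure_posPart_eq_iSup _ h𝒜 hgen MeasurableSet.univ]
    simpa using fun A hA => (h A hA).ge
  rw [signedMeasure_apply_eq_sub s hB, measureReal_def, measureReal_def,
    measure_mono_null (subset_univ _) hp, measure_mono_null (subset_univ _) hn]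
  simp

/-- Pushing `κ t` forward under `x ↦ (x, t)` makes the integrand independent of `t`. The image
measures depend measurably on `t` because they do so on rectangles. -/
theorem measurable_lintegral_of_isFiniteMeasure {ι α : Type*} [MeasurableSpace ι]
    [MeasurableSpace α] {κ : ι → Measure α} [∀ t, IsFiniteMeasure (κ t)]
    (hκ : ∀ B, MeasurableSet B → Measurable fun t => κ t B) {F : α × ι → ℝ≥0∞}
    (hF : Measurable F) : Measurable fun t => ∫⁻ x, F (x, t) ∂κ t := by
  have hmap : Measurable fun t => (κ t).map fun x => (x, t) := by
    have hfin : ∀ t, IsFiniteMeasure ((κ t).map fun x => (x, t)) := fun t => inferInstance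
    refine Measurable.measure_of_isPiSystem generateFrom_prod.symm isPiSystem_prod ?_ ?_
    · rintro _ ⟨A, hA, C, hC, rfl⟩
      have : ∀ t, (κ t).map (fun x => (x, t)) (A ×ˢ C) = C.indicator (fun t => κ t A) t := by
        intro t
        rw [Measure.map_apply (by fun_prop) (hA.prod hC)]
        by_cases ht : t ∈ C
        · rw [indicator_of_mem ht, mk_preimage_prod_left ht]
        · rw [indicator_of_notMem ht, mk_preimage_prod_left_eq_empty ht, measure_empty]
      simp only [this]
      exact (hκ A hA).indicator hC
    · have : ∀ t, (κ t).map (fun x => (x, t)) univ = κ t univ := fun t => by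
        rw [Measure.map_apply (by fun_prop) MeasurableSet.univ, preimage_univ]
      simp only [this]
      exact hκ _ MeasurableSet.univ
  have h := (Measure.measurable_lintegral hF).comp hmap
  have e : ∀ t, ∫⁻ x, F (x, t) ∂κ t = ∫⁻ p, F p ∂(κ t).map fun x => (x, t) := fun t =>
    (lintegral_map hF (by fun_prop)).symm
  simp only [e]
  exact h

namespace LocBddMeasure

variable {ι : Type*} [MeasurableSpace ι] {E : Type*} [NormedAddCommGroup E] [MeasurableSpace E]

/-- A family of locally bounded measures depending measurably on a parameter. -/
def MeasurableFamily (n : ι → LocBddMeasure E) : Prop :=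
  ∀ B, MeasurableSet B → Bornology.IsBounded B → Measurable fun t => n t B

theorem MeasurableFamily.sub {n₁ n₂ : ι → LocBddMeasure E} (h₁ : MeasurableFamily n₁)
    (h₂ : MeasurableFamily n₂) : MeasurableFamily fun t => n₁ t - n₂ t :=
  fun B hB hb => (h₁ B hB hb).sub (h₂ B hB hb)

variable [BorelSpace E] [ProperSpace E]

theorem MeasurableFamily.measurable_restr_parts {n : ι → LocBddMeasure E}
    (hn : MeasurableFamily n) (j : ℕ) {B : Set E} (hB : MeasurableSet B) :
    (Measurable fun t => ((n t).restr (shell E j) (measurableSet_shell j)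
      (isBounded_shell j)).toJordanDecomposition.posPart B) ∧
    Measurable fun t => ((n t).restr (shell E j) (measurableSet_shell j)
      (isBounded_shell j)).toJordanDecomposition.negPart B := by
  obtain ⟨𝒜, hc, h𝒜, hgen⟩ := exists_countable_isSetAlgebra E
  have hm : ∀ A ∈ 𝒜, Measurable fun t => (n t).restr (shell E j) (measurableSet_shell j)
      (isBounded_shell j) (A ∩ B) := by
    intro A hA
    have hAm : MeasurableSet A := by
      rw [hgen]; exact MeasurableSpace.measurableSet_generateFrom hA
    simp only [restr_apply _ _ _ (hAm.inter hB)]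
    exact hn _ ((hAm.inter hB).inter (measurableSet_shell j))
      ((isBounded_shell j).subset inter_subset_right)
  constructor
  · simp only [signedMeasure_posPart_eq_iSup _ h𝒜 hgen hB]
    exact Measurable.biSup _ hc fun A hA => (hm A hA).ennreal_ofReal
  · simp only [signedMeasure_negPart_eq, signedMeasure_posPart_eq_iSup _ h𝒜 hgen hB]
    exact Measurable.biSup _ hc fun A hA => (hm A hA).neg.ennreal_ofReal

theorem MeasurableFamily.measurable_lintegral_posPart {n : ι → LocBddMeasure E}
    (hn : MeasurableFamily n) {F : E × ι → ℝ≥0∞} (hF : Measurable F) :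
    Measurable fun t => ∫⁻ x, F (x, t) ∂(n t).posPart := by
  simp only [posPart, lintegral_sum_measure]
  exact Measurable.tsum fun j => measurable_lintegral_of_isFiniteMeasure
    (fun B hB => (hn.measurable_restr_parts j hB).1) hF

theorem MeasurableFamily.measurable_lintegral_negPart {n : ι → LocBddMeasure E}
    (hn : MeasurableFamily n) {F : E × ι → ℝ≥0∞} (hF : Measurable F) :
    Measurable fun t => ∫⁻ x, F (x, t) ∂(n t).negPart := by
  simp only [negPart, lintegral_sum_measure]
  exact Measurable.tsum fun j => measurable_lintegral_of_isFiniteMeasure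
    (fun B hB => (hn.measurable_restr_parts j hB).2) hF

theorem MeasurableFamily.measurable_lintegral_variation {n : ι → LocBddMeasure E}
    (hn : MeasurableFamily n) {F : E × ι → ℝ≥0∞} (hF : Measurable F) :
    Measurable fun t => ∫⁻ x, F (x, t) ∂(n t).variation := by
  simp only [variation, lintegral_add_measure]
  exact (hn.measurable_lintegral_posPart hF).add (hn.measurable_lintegral_negPart hF)

theorem MeasurableFamily.aemeasurable_integral {n : ι → LocBddMeasure E}
    (hn : MeasurableFamily n) {F : E × ι → ℝ} (hF : Measurable F) {ρ : Measure ι}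
    (hi : ∀ᵐ t ∂ρ, Integrable (fun x => F (x, t)) (n t).variation) :
    AEMeasurable (fun t => (n t).integral fun x => F (x, t)) ρ := by
  have m1 := (hn.measurable_lintegral_posPart hF.ennreal_ofReal).ennreal_toReal
  have m2 := (hn.measurable_lintegral_posPart hF.neg.ennreal_ofReal).ennreal_toReal
  have m3 := (hn.measurable_lintegral_negPart hF.ennreal_ofReal).ennreal_toReal
  have m4 := (hn.measurable_lintegral_negPart hF.neg.ennreal_ofReal).ennreal_toReal
  refine ((m1.sub m2).sub (m3.sub m4)).aemeasurable.congr ?_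
  filter_upwards [hi] with t ht
  simp only [integral]
  rw [integral_eq_lintegral_pos_part_sub_lintegral_neg_part
      (ht.mono_measure (n t).posPart_le_variation),
    integral_eq_lintegral_pos_part_sub_lintegral_neg_part
      (ht.mono_measure (n t).negPart_le_variation)]
  simp

/-- A Dynkin class argument inside each shell, where the mass is finite and complements can be
subtracted; a bounded set is then summed over the shells. -/
theorem MeasurableFamily.of_algebra {n : ι → LocBddMeasure E} {𝒜 : Set (Set E)}
    (h𝒜 : IsSetAlgebra 𝒜)
    (hgen : ‹MeasurableSpace E› = MeasurableSpace.generateFrom 𝒜)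
    (h : ∀ A ∈ 𝒜, ∀ j, Measurable fun t => n t (A ∩ shell E j)) : MeasurableFamily n := by
  have key : ∀ j, ∀ A, MeasurableSet A → Measurable fun t => n t (A ∩ shell E j) := by
    intro j A hA
    induction A, hA using MeasurableSpace.induction_on_inter hgen
      (fun A hA B hB _ => h𝒜.inter_mem hA hB) with
    | empty => simp [empty_eq_zero]
    | basic A hA => exact h A hA j
    | compl A hA ih =>
      have hu := h _ h𝒜.univ_mem j
      have e : ∀ t, n t (Aᶜ ∩ shell E j) = n t (univ ∩ shell E j) - n t (A ∩ shell E j) := by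
        intro t
        rw [← restr_apply _ (measurableSet_shell j) (isBounded_shell j) hA.compl,
          ← restr_apply _ (measurableSet_shell j) (isBounded_shell j) hA,
          ← restr_apply _ (measurableSet_shell j) (isBounded_shell j) MeasurableSet.univ,
          VectorMeasure.of_compl hA]
      simp only [e]
      exact hu.sub ih
    | iUnion f hd hf ih =>
      refine measurable_of_tendsto_metrizable
        (f := fun N t => ∑ i ∈ Finset.range N, n t (f i ∩ shell E j))
        (fun N => Finset.measurable_fun_sum _ fun i _ => ih i) (tendsto_pi_nhds.2 fun t => ?_)
      have := ((n t).restr (shell E j) (measurableSet_shell j) (isBounded_shell j)).m_iUnion hf hd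
      rw [restr_apply _ _ _ (MeasurableSet.iUnion hf)] at this
      simp only [restr_apply _ _ _ (hf _)] at this
      exact this.tendsto_sum_nat
  intro B hB hb
  exact measurable_of_tendsto_metrizable
    (f := fun N t => ∑ j ∈ Finset.range N, n t (B ∩ shell E j))
    (fun N => Finset.measurable_fun_sum _ fun j _ => key j B hB)
    (tendsto_pi_nhds.2 fun t => (hasSum_inter_shell (n t) hB hb).tendsto_sum_nat)

/-- A family that is a.e. measurable on each bounded Borel set has a measurable version. -/
theorem exists_measurableFamily_ae_eq {m : ι → LocBddMeasure E} {ρ : Measure ι}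
    (hm : ∀ B, MeasurableSet B → Bornology.IsBounded B → AEMeasurable (fun t => m t B) ρ) :
    ∃ n : ι → LocBddMeasure E, MeasurableFamily n ∧ ∀ᵐ t ∂ρ, m t = n t := by
  classical
  obtain ⟨𝒜, hc, h𝒜, hgen⟩ := exists_countable_isSetAlgebra E
  have hAm : ∀ A ∈ 𝒜, MeasurableSet A := fun A hA => by
    rw [hgen]; exact MeasurableSpace.measurableSet_generateFrom hA
  have hae : ∀ A ∈ 𝒜, ∀ j, AEMeasurable (fun t => m t (A ∩ shell E j)) ρ := fun A hA j =>
    hm _ ((hAm A hA).inter (measurableSet_shell j))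
      ((isBounded_shell j).subset inter_subset_right)
  have hev : ∀ᵐ t ∂ρ, ∀ A, ∀ hA : A ∈ 𝒜, ∀ j,
      m t (A ∩ shell E j) = (hae A hA j).mk _ t := by
    rw [ae_ball_iff hc]
    exact fun A hA => ae_all_iff.2 fun j => (hae A hA j).ae_eq_mk
  -- The algebra is countable, so one measurable set `S` of full measure serves all its members; off
  -- `S` the family is replaced by 0.
  obtain ⟨S, hSae, hS, hSe⟩ := hev.exists_measurable_mem
  refine ⟨fun t => if t ∈ S then m t else 0, ?_, ?_⟩
  · refine MeasurableFamily.of_algebra h𝒜 hgen fun A hA j => ?_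
    have : (fun t => (if t ∈ S then m t else 0 : LocBddMeasure E) (A ∩ shell E j))
        = S.indicator ((hae A hA j).mk _) := by
      funext t
      by_cases ht : t ∈ S
      · rw [if_pos ht, indicator_of_mem ht, hSe t ht A hA j]
      · rw [if_neg ht, indicator_of_notMem ht, zero_apply]
    rw [this]
    exact (hae A hA j).measurable_mk.indicator hS
  · filter_upwards [hSae] with t ht
    rw [if_pos ht]

end LocBddMeasure

end Families

/-! ### Families that annihilate smooth functions -/

section Vanishing

namespace LocBddMeasure

variable {ι : Type*} [MeasurableSpace ι] {E : Type*} [NormedAddCommGroup E]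
  [InnerProductSpace ℝ E] [FiniteDimensional ℝ E]

/-- Take a smooth nonnegative function that is nonzero exactly on `O`, multiply it by `k` and
compose with a smooth step. -/
theorem exists_contDiff_tendsto_indicator {O : Set E} (hO : IsOpen O) :
    ∃ ψ : ℕ → E → ℝ, (∀ k, ContDiff ℝ ∞ (ψ k)) ∧ (∀ k x, |ψ k x| ≤ O.indicator 1 x) ∧
      ∀ x, Tendsto (fun k => ψ k x) atTop (𝓝 (O.indicator 1 x)) := by
  obtain ⟨f, hfs, hfc, hfr⟩ := hO.exists_contDiff_support_eq (n := ⊤)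
  have hf0 : ∀ x, 0 ≤ f x := fun x => (hfr ⟨x, rfl⟩).1
  have hz : ∀ x ∉ O, f x = 0 := fun x hx => by
    rw [← hfs] at hx; simpa using hx
  refine ⟨fun k x => Real.smoothTransition (k * f x), fun k => ?_, fun k x => ?_, fun x => ?_⟩
  · exact Real.smoothTransition.contDiff.comp (contDiff_const.mul hfc)
  · rw [abs_of_nonneg (Real.smoothTransition.nonneg _)]
    by_cases hx : x ∈ O
    · rw [indicator_of_mem hx]; exact Real.smoothTransition.le_one _
    · rw [indicator_of_notMem hx, hz x hx, mul_zero, Real.smoothTransition.zero]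
  · by_cases hx : x ∈ O
    · rw [indicator_of_mem hx]
      have hpos : 0 < f x := (hf0 x).lt_of_ne' (by rw [← hfs] at hx; exact hx)
      obtain ⟨N, hN⟩ := exists_nat_ge (1 / f x)
      refine tendsto_const_nhds.congr' ?_
      filter_upwards [eventually_ge_atTop N] with k hk
      refine (Real.smoothTransition.one_of_one_le ?_).symm
      rw [← div_le_iff₀ hpos]
      exact hN.trans (by exact_mod_cast hk)
    · rw [indicator_of_notMem hx]
      simp [hz x hx, Real.smoothTransition.zero]

variable [MeasurableSpace E] [BorelSpace E]

theorem integral_tendsto_of_tendsto_indicator (m : LocBddMeasure E) {O : Set E} (hO : IsOpen O)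
    (hb : Bornology.IsBounded O) {ψ : ℕ → E → ℝ} (hψ : ∀ k, Continuous (ψ k))
    (hle : ∀ k x, |ψ k x| ≤ O.indicator 1 x)
    (hlim : ∀ x, Tendsto (fun k => ψ k x) atTop (𝓝 (O.indicator 1 x))) :
    Tendsto (fun k => m.integral (ψ k)) atTop (𝓝 (m O)) := by
  rw [← integral_indicator_one m hO.measurableSet hb]
  have key : ∀ μ : Measure E, μ O ≠ ⊤ →
      Tendsto (fun k => ∫ x, ψ k x ∂μ) atTop (𝓝 (∫ x, O.indicator 1 x ∂μ)) := by
    intro μ hμ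
    refine tendsto_integral_of_dominated_convergence (O.indicator 1)
      (fun k => (hψ k).aestronglyMeasurable) ?_ (fun k => Eventually.of_forall (hle k))
      (Eventually.of_forall hlim)
    exact (integrable_indicator_iff hO.measurableSet).2 (integrableOn_const hμ)
  exact (key _ (posPart_ne_top m hb)).sub (key _ (negPart_ne_top m hb))

/-- A family annihilating smooth compactly supported functions for a.e. parameter vanishes. -/
theorem ae_eq_zero_of_forall_integral_eq_zero {n : ι → LocBddMeasure E} {ρ : Measure ι}
    (h : ∀ ψ : E → ℝ, ContDiff ℝ ∞ ψ → HasCompactSupport ψ →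
      ∀ᵐ t ∂ρ, (n t).integral ψ = 0) : ∀ᵐ t ∂ρ, n t = 0 := by
  have hopen : ∀ O : Set E, IsOpen O → Bornology.IsBounded O → ∀ᵐ t ∂ρ, n t O = 0 := by
    intro O hO hb
    obtain ⟨ψ, hψ, hle, hlim⟩ := exists_contDiff_tendsto_indicator hO
    have hcs : ∀ k, HasCompactSupport (ψ k) := fun k =>
      HasCompactSupport.intro hb.isCompact_closure fun x hx => by
        have := hle k x
        rw [indicator_of_notMem fun h => hx (subset_closure h)] at this
        exact abs_nonpos_iff.1 this
    filter_upwards [ae_all_iff.2 fun k => h (ψ k) (hψ k) (hcs k)] with t ht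
    refine tendsto_nhds_unique (integral_tendsto_of_tendsto_indicator (n t) hO hb
      (fun k => (hψ k).continuous) hle hlim) ?_
    simp [ht]
  -- Here the null set may depend on `A`: the induction combines only countably many sets at a time.
  have hball : ∀ (J : ℕ) (A : Set E), MeasurableSet A →
      ∀ᵐ t ∂ρ, n t (A ∩ Metric.ball 0 J) = 0 := by
    intro J A hA
    induction A, hA using MeasurableSpace.induction_on_inter (BorelSpace.measurable_eq (α := E))
      isPiSystem_isOpen with
    | empty => simp [empty_eq_zero]
    | basic A hA =>
      exact hopen _ (IsOpen.inter hA Metric.isOpen_ball) (Metric.isBounded_ball.subset inter_subset_right)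
    | compl A hA ih =>
      filter_upwards [ih, hopen _ Metric.isOpen_ball (Metric.isBounded_ball (x := 0) (r := J))]
        with t h1 h2
      have e := VectorMeasure.of_compl (v := (n t).restr (Metric.ball 0 J)
        Metric.isOpen_ball.measurableSet Metric.isBounded_ball) hA
      rw [restr_apply _ _ _ hA.compl, restr_apply _ _ _ hA, restr_apply _ _ _ MeasurableSet.univ,
        univ_inter, h1, h2, sub_zero] at e
      exact e
    | iUnion f hd hf ih =>
      filter_upwards [ae_all_iff.2 ih] with t ht
      have := ((n t).restr (Metric.ball 0 J) Metric.isOpen_ball.measurableSet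
        Metric.isBounded_ball).m_iUnion hf hd
      rw [restr_apply _ _ _ (MeasurableSet.iUnion hf)] at this
      simp only [restr_apply _ _ _ (hf _), ht] at this
      exact this.unique hasSum_zero
  obtain ⟨𝒜, hc, h𝒜, hgen⟩ := exists_countable_isSetAlgebra E
  have hAm : ∀ A ∈ 𝒜, MeasurableSet A := fun A hA => by
    rw [hgen]; exact MeasurableSpace.measurableSet_generateFrom hA
  -- A countable generating algebra gives one null set for all its members, and vanishing on the
  -- algebra forces the measure to vanish on each ball.
  have hev : ∀ᵐ t ∂ρ, ∀ J : ℕ, ∀ A ∈ 𝒜, n t (A ∩ Metric.ball 0 J) = 0 :=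
    ae_all_iff.2 fun J => (ae_ball_iff hc).2 fun A hA => hball J A (hAm A hA)
  filter_upwards [hev] with t ht
  refine ext_of_apply fun B hB hb => ?_
  obtain ⟨J, hJ⟩ := exists_subset_ball_nat hb
  have := signedMeasure_eq_zero_of_algebra (s := (n t).restr (Metric.ball 0 J)
    Metric.isOpen_ball.measurableSet Metric.isBounded_ball) h𝒜 hgen
    (fun A hA => by rw [restr_apply _ _ _ (hAm A hA)]; exact ht J A hA) hB
  rwa [restr_apply _ _ _ hB, inter_eq_left.2 hJ] at this

end LocBddMeasure

end Vanishing

/-! ### The equation for the difference of two solutions -/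

section Solutions

open LocBddMeasure

variable {d : ℕ}

local notation "𝔼" => EuclideanSpace ℝ (Fin d)

theorem isTestFunction_of_contDiff (T : ℝ) {u : 𝔼 × ℝ → ℝ} (hu : ContDiff ℝ 1 u)
    (hc : HasCompactSupport u) : IsTestFunction T fun x t => u (x, t) where
  contDiffOn := hu.contDiffOn
  support := by
    obtain ⟨R, hR⟩ := hc.isCompact.isBounded.exists_norm_le
    refine ⟨R, fun x hx t _ => image_eq_zero_of_notMem_tsupport fun h => ?_⟩
    exact absurd ((le_max_left _ _).trans (hR _ h)) (not_le.2 hx)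

theorem deriv_add_inner_gradient {u : 𝔼 × ℝ → ℝ} (hu : ContDiff ℝ 1 u) (x v : 𝔼) (s : ℝ) :
    deriv (fun τ => u (x, τ)) s + inner ℝ v (gradient (fun y => u (y, s)) x)
      = fderiv ℝ u (x, s) (v, 1) := by
  have hd := (hu.differentiable one_ne_zero (x, s)).hasFDerivAt
  have h1 : HasDerivAt (fun τ => u (x, τ)) (fderiv ℝ u (x, s) (0, 1)) s :=
    hd.comp_hasDerivAt s ((hasDerivAt_const s x).prodMk (hasDerivAt_id s))
  have h2 : HasFDerivAt (fun y => u (y, s))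
      ((fderiv ℝ u (x, s)).comp ((ContinuousLinearMap.id ℝ 𝔼).prod 0)) x :=
    hd.comp x ((hasFDerivAt_id x).prodMk (hasFDerivAt_const s x))
  rw [h1.deriv, real_inner_comm, gradient, InnerProductSpace.toDual_symm_apply, h2.fderiv]
  simp only [ContinuousLinearMap.comp_apply, ContinuousLinearMap.prod_apply,
    ContinuousLinearMap.id_apply, _root_.zero_apply]
  rw [← map_add]
  simp

theorem measurable_fderiv_apply_field {b : 𝔼 → ℝ → 𝔼}
    (hb : Measurable fun p : 𝔼 × ℝ => b p.1 p.2) {u : 𝔼 × ℝ → ℝ} (hu : ContDiff ℝ 1 u) :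
    Measurable fun p : 𝔼 × ℝ => fderiv ℝ u p (b p.1 p.2, 1) := by
  have hc : Continuous fun q : (𝔼 × ℝ) × 𝔼 => fderiv ℝ u q.1 (q.2, 1) :=
    ((hu.continuous_fderiv one_ne_zero).comp continuous_fst).clm_apply (by fun_prop)
  exact hc.measurable.comp (measurable_id.prodMk hb)

theorem exists_radius_of_hasCompactSupport {E G : Type*} [NormedAddCommGroup E]
    [NormedAddCommGroup G] {g : E × ℝ → G} (hg : HasCompactSupport g) :
    ∃ R : ℝ, 0 < R ∧ ∀ s, ∀ x ∉ Metric.ball (0 : E) R, g (x, s) = 0 := by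
  obtain ⟨R, hR0, hR⟩ := Bornology.IsBounded.exists_pos_norm_lt (IsCompact.isBounded hg)
  refine ⟨R, hR0, fun s x hx => image_eq_zero_of_notMem_tsupport fun h => hx ?_⟩
  rw [mem_ball_zero_iff]
  exact (le_max_left _ _).trans_lt (hR _ h)

theorem exists_enorm_fderiv_apply_field_le {E : Type*} [NormedAddCommGroup E] [NormedSpace ℝ E]
    (b : E → ℝ → E) {u : E × ℝ → ℝ} (hu : ContDiff ℝ 1 u) (hc : HasCompactSupport u) :
    ∃ (C : ℝ≥0∞) (R : ℝ), C ≠ ⊤ ∧ 0 < R ∧ ∀ x s, ‖fderiv ℝ u (x, s) (b x s, 1)‖ₑ ≤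
      C * (Metric.ball 0 R).indicator (fun y => ‖b y s‖ₑ + 1) x := by
  have hs := hc.fderiv (𝕜 := ℝ)
  obtain ⟨C, hC⟩ := hs.exists_bound_of_continuous (hu.continuous_fderiv one_ne_zero)
  obtain ⟨R, hR0, hR⟩ := exists_radius_of_hasCompactSupport hs
  refine ⟨ENNReal.ofReal C, R, ENNReal.ofReal_ne_top, hR0, fun x s => ?_⟩
  by_cases hx : x ∈ Metric.ball 0 R
  · have hC0 : 0 ≤ C := (norm_nonneg _).trans (hC (x, s))
    have h1 : ‖fderiv ℝ u (x, s) (b x s, 1)‖ ≤ C * (‖b x s‖ + 1) := by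
      refine (ContinuousLinearMap.le_opNorm _ _).trans (mul_le_mul (hC _) ?_ (norm_nonneg _) hC0)
      refine max_le ?_ ?_ <;> simp
    rw [indicator_of_mem hx, ← ofReal_norm, ← ofReal_norm, ← ENNReal.ofReal_one,
      ← ENNReal.ofReal_add (norm_nonneg _) zero_le_one, ← ENNReal.ofReal_mul hC0]
    exact ENNReal.ofReal_le_ofReal h1
  · rw [hR s x hx]
    simp

/-- The mass of a ball is integrable in time along a family defining a locally bounded measure. -/
theorem IsGivenBy.lintegral_variation_ball_lt_top {T : ℝ}
    {μ : LocBddMeasure (𝔼 × Icc (0 : ℝ) T)} {m : ℝ → LocBddMeasure 𝔼} (h : IsGivenBy T μ m)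
    (R : ℝ) : ∫⁻ t in Icc 0 T, (m t).variation (Metric.ball 0 R) < ⊤ := by
  refine lt_of_le_of_lt ?_ (h.integrable (Metric.closedBall 0 R) (isCompact_closedBall _ _)).2
  refine lintegral_mono fun t => ?_
  rw [Real.enorm_of_nonneg ENNReal.toReal_nonneg,
    ENNReal.ofReal_toReal (variation_ne_top _ Metric.isBounded_closedBall)]
  exact measure_mono Metric.ball_subset_closedBall

/-- The measurable version makes the space integrals measurable in time. With `|∂_t u + ⟨b, ∇u⟩| ≤ C
(|b| + 1)` on a ball this yields the integrability needed to subtract two such equations. -/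
theorem IsSolution.exists_measurable_version {T : ℝ} {b : 𝔼 → ℝ → 𝔼}
    (hb : Measurable fun p : 𝔼 × ℝ => b p.1 p.2) {ν : LocBddMeasure 𝔼}
    {μ : LocBddMeasure (𝔼 × Icc (0 : ℝ) T)} {m : ℝ → LocBddMeasure 𝔼}
    (h : IsSolution T b ν μ m) :
    ∃ n : ℝ → LocBddMeasure 𝔼, MeasurableFamily n ∧
      (∀ᵐ t ∂(volume.restrict (Icc 0 T)), m t = n t) ∧
      ∀ u : 𝔼 × ℝ → ℝ, ContDiff ℝ 1 u → HasCompactSupport u →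
        (∀ᵐ t ∂(volume.restrict (Icc 0 T)),
          Integrable (fun x => fderiv ℝ u (x, t) (b x t, 1)) (n t).variation) ∧
        IntegrableOn (fun t => (n t).integral fun x => fderiv ℝ u (x, t) (b x t, 1)) (Icc 0 T) ∧
        ∀ᵐ t ∂(volume.restrict (Icc 0 T)), (n t).integral (fun x => u (x, t)) =
          ν.integral (fun x => u (x, 0)) +
            ∫ s in (0 : ℝ)..t, (n s).integral fun x => fderiv ℝ u (x, s) (b x s, 1) := by
  obtain ⟨n, hn, hae⟩ := exists_measurableFamily_ae_eq h.isGivenBy.aemeasurable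
  refine ⟨n, hn, hae, fun u hu hc => ?_⟩
  obtain ⟨C, R, hC, hR0, hCR⟩ := exists_enorm_fderiv_apply_field_le b hu hc
  have hmeas := measurable_fderiv_apply_field hb hu
  have hbm : Measurable fun p : 𝔼 × ℝ => ‖b p.1 p.2‖ₑ := hb.enorm
  have hball : MeasurableSet (Metric.ball (0 : 𝔼) R) := Metric.isOpen_ball.measurableSet
  have hfin : ∫⁻ t in Icc 0 T, ∫⁻ x, ‖fderiv ℝ u (x, t) (b x t, 1)‖ₑ ∂(n t).variation < ⊤ := by
    have hle : ∀ t, ∫⁻ x, ‖fderiv ℝ u (x, t) (b x t, 1)‖ₑ ∂(n t).variation ≤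
        C * (∫⁻ x in Metric.ball 0 R, ‖b x t‖ₑ ∂(n t).variation
          + (n t).variation (Metric.ball 0 R)) := by
      intro t
      refine (lintegral_mono fun x => hCR x t).trans (le_of_eq ?_)
      rw [lintegral_const_mul' _ _ hC, lintegral_indicator hball,
        lintegral_add_right _ measurable_const]
      simp
    refine (lintegral_mono hle).trans_lt ?_
    have hm2 : Measurable fun t => (n t).variation (Metric.ball 0 R) := by
      have := hn.measurable_lintegral_variation
        (F := fun p : 𝔼 × ℝ => (Metric.ball (0 : 𝔼) R).indicator 1 p.1)
        ((measurable_one.indicator hball).comp measurable_fst)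
      simpa [lintegral_indicator_one hball] using this
    rw [lintegral_const_mul' _ _ hC, lintegral_add_right _ hm2]
    refine ENNReal.mul_lt_top hC.lt_top (ENNReal.add_lt_top.2 ⟨?_, ?_⟩)
    · refine lt_of_eq_of_lt (lintegral_congr_ae ?_) (h.integrable_drift 0 R hR0)
      filter_upwards [hae] with t ht
      rw [ht]
    · refine lt_of_eq_of_lt (lintegral_congr_ae ?_)
        (h.isGivenBy.lintegral_variation_ball_lt_top R)
      filter_upwards [hae] with t ht
      rw [ht]
  have hint : ∀ᵐ t ∂(volume.restrict (Icc 0 T)),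
      Integrable (fun x => fderiv ℝ u (x, t) (b x t, 1)) (n t).variation := by
    filter_upwards [ae_lt_top (hn.measurable_lintegral_variation
      (F := fun p : 𝔼 × ℝ => ‖fderiv ℝ u p (b p.1 p.2, 1)‖ₑ) hmeas.enorm) hfin.ne] with t ht
    exact ⟨(hmeas.comp measurable_prodMk_right).aestronglyMeasurable, ht⟩
  refine ⟨hint, ⟨(hn.aemeasurable_integral (F := fun p : 𝔼 × ℝ => fderiv ℝ u p (b p.1 p.2, 1))
    hmeas hint).aestronglyMeasurable, ?_⟩, ?_⟩
  · exact (lintegral_mono fun t => enorm_integral_le _ _).trans_lt hfin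
  · filter_upwards [h.equation _ (isTestFunction_of_contDiff T hu hc), hae,
      ae_restrict_mem measurableSet_Icc] with t ht htn htT
    rw [← htn, ht]
    congr 1
    refine intervalIntegral.integral_congr_ae ?_
    have hae' := (ae_restrict_iff' measurableSet_Icc).1 hae
    filter_upwards [hae'] with s hs hst
    rw [uIoc_of_le htT.1] at hst
    rw [hs ⟨hst.1.le, hst.2.trans htT.2⟩]
    congr 1
    funext x
    exact deriv_add_inner_gradient hu x (b x s) s

theorem integrable_variation_of_continuous (m : LocBddMeasure 𝔼) {g : 𝔼 → ℝ} (hg : Continuous g)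
    {R : ℝ} (hR : ∀ x ∉ Metric.ball 0 R, g x = 0) : Integrable g m.variation := by
  rw [← integrableOn_iff_integrable_of_support_subset (s := Metric.ball 0 R)
    fun x hx => by by_contra h; exact hx (hR x h)]
  obtain ⟨C, hC⟩ := (isCompact_closedBall (0 : 𝔼) R).exists_bound_of_continuousOn hg.continuousOn
  refine Measure.integrableOn_of_bounded (M := C) (variation_ne_top m Metric.isBounded_ball)
    hg.aestronglyMeasurable ?_
  filter_upwards [ae_restrict_mem Metric.isOpen_ball.measurableSet] with x hx
  exact hC x (Metric.ball_subset_closedBall hx)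

/-- The difference of two solutions with the same initial data solves the equation with zero
initial data. -/
theorem exists_measurable_difference {T : ℝ} {b : 𝔼 → ℝ → 𝔼}
    (hb : Measurable fun p : 𝔼 × ℝ => b p.1 p.2) {ν : LocBddMeasure 𝔼}
    {μ₁ μ₂ : LocBddMeasure (𝔼 × Icc (0 : ℝ) T)} {m₁ m₂ : ℝ → LocBddMeasure 𝔼}
    (h₁ : IsSolution T b ν μ₁ m₁) (h₂ : IsSolution T b ν μ₂ m₂) :
    ∃ n : ℝ → LocBddMeasure 𝔼, MeasurableFamily n ∧
      (∀ᵐ t ∂(volume.restrict (Icc 0 T)), m₁ t - m₂ t = n t) ∧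
      ∀ u : 𝔼 × ℝ → ℝ, ContDiff ℝ 1 u → HasCompactSupport u →
        ∀ᵐ t ∂(volume.restrict (Icc 0 T)), (n t).integral (fun x => u (x, t)) =
            ∫ s in (0 : ℝ)..t, (n s).integral fun x => fderiv ℝ u (x, s) (b x s, 1) := by
  obtain ⟨n₁, hn₁, hae₁, H₁⟩ := h₁.exists_measurable_version hb
  obtain ⟨n₂, hn₂, hae₂, H₂⟩ := h₂.exists_measurable_version hb
  refine ⟨fun t => n₁ t - n₂ t, hn₁.sub hn₂, ?_, fun u hu hc => ?_⟩
  · filter_upwards [hae₁, hae₂] with t h1 h2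
    rw [h1, h2]
  · obtain ⟨i₁, I₁, e₁⟩ := H₁ u hu hc
    obtain ⟨i₂, I₂, e₂⟩ := H₂ u hu hc
    obtain ⟨R, -, hz⟩ := exists_radius_of_hasCompactSupport hc
    have hcont : ∀ t, Continuous fun x => u (x, t) := fun t => hu.continuous.comp (by fun_prop)
    filter_upwards [e₁, e₂, ae_restrict_mem measurableSet_Icc] with t h1 h2 htT
    rw [integral_sub_apply _ _ (integrable_variation_of_continuous _ (hcont t) (hz t))
      (integrable_variation_of_continuous _ (hcont t) (hz t)), h1, h2, add_sub_add_left_eq_sub,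
      ← intervalIntegral.integral_sub]
    · refine intervalIntegral.integral_congr_ae ?_
      filter_upwards [(ae_restrict_iff' measurableSet_Icc).1 i₁,
        (ae_restrict_iff' measurableSet_Icc).1 i₂] with s hs₁ hs₂ hst
      rw [uIoc_of_le htT.1] at hst
      have hsT : s ∈ Icc 0 T := ⟨hst.1.le, hst.2.trans htT.2⟩
      exact (integral_sub_apply _ _ (hs₁ hsT) (hs₂ hsT)).symm
    · exact (intervalIntegrable_iff_integrableOn_Icc_of_le htT.1).2
        (I₁.mono_set (Icc_subset_Icc_right htT.2))
    · exact (intervalIntegrable_iff_integrableOn_Icc_of_le htT.1).2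
        (I₂.mono_set (Icc_subset_Icc_right htT.2))

end Solutions

/-! ### Cutoffs in space and the algebra of the Lyapunov condition -/

section Cutoff

theorem contDiff_smul_of_tsupport_subset {F G : Type*} [NormedAddCommGroup F] [NormedSpace ℝ F]
    [NormedAddCommGroup G] [NormedSpace ℝ G] {n : WithTop ℕ∞} {g : F → ℝ} {h : F → G} {U : Set F}
    (hU : IsOpen U) (hg : ContDiff ℝ n g) (hsupp : tsupport g ⊆ U) (hh : ContDiffOn ℝ n h U) :
    ContDiff ℝ n fun p => g p • h p := by
  refine contDiff_iff_contDiffAt.2 fun p => ?_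
  by_cases hp : p ∈ U
  · exact hg.contDiffAt.smul (hh.contDiffAt (hU.mem_nhds hp))
  · have hz : (fun p => g p • h p) =ᶠ[𝓝 p] fun _ => 0 := by
      filter_upwards [notMem_tsupport_iff_eventuallyEq.1 fun h' => hp (hsupp h')] with y hy
      simp [hy]
    exact contDiffAt_const.congr_of_eventuallyEq hz

variable {E : Type*} [NormedAddCommGroup E] [InnerProductSpace ℝ E]

theorem fderiv_apply_inl_eq {a : E × ℝ → E} {x : E} {t : ℝ} (ha : DifferentiableAt ℝ a (x, t))
    (ξ : E) : fderiv ℝ a (x, t) (ξ, 0) = fderiv ℝ (fun y => a (y, t)) x ξ := by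
  have h : HasFDerivAt (fun y => a (y, t))
      ((fderiv ℝ a (x, t)).comp ((ContinuousLinearMap.id ℝ E).prod 0)) x :=
    ha.hasFDerivAt.comp x ((hasFDerivAt_id x).prodMk (hasFDerivAt_const t x))
  rw [h.fderiv]
  simp

theorem norm_sub_le_of_norm_fderiv_le {ψ : E → ℝ} (hψ : ContDiff ℝ 1 ψ) {L : ℝ}
    (hL : ∀ x, ‖fderiv ℝ ψ x‖ ≤ L) (x y : E) : |ψ y - ψ x| ≤ L * ‖y - x‖ :=
  Convex.norm_image_sub_le_of_norm_fderiv_le (fun z _ => hψ.differentiable one_ne_zero z)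
    (fun z _ => hL z) convex_univ trivial trivial

variable [FiniteDimensional ℝ E]

theorem exists_scaled_cutoff (E : Type*) [NormedAddCommGroup E] [InnerProductSpace ℝ E]
    [FiniteDimensional ℝ E] :
    ∃ G : ℝ, 0 ≤ G ∧ ∀ N : ℕ, 0 < N → ∃ φ : E → ℝ, ContDiff ℝ ∞ φ ∧ (∀ x, 0 ≤ φ x ∧ φ x ≤ 1) ∧
      (∀ x, ‖x‖ ≤ N → φ x = 1) ∧ (∀ x, 2 * N ≤ ‖x‖ → φ x = 0) ∧
      (∀ x v, |fderiv ℝ φ x v| ≤ G * (N : ℝ)⁻¹ * ‖v‖) ∧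
      ∀ x, ¬(N < ‖x‖ ∧ ‖x‖ < 2 * N) → fderiv ℝ φ x = 0 := by
  obtain ⟨f, hfc, hf01, hf1, hf0, G, hG⟩ : ∃ f : E → ℝ, ContDiff ℝ ∞ f ∧
      (∀ x, 0 ≤ f x ∧ f x ≤ 1) ∧ (∀ x, ‖x‖ ≤ 1 → f x = 1) ∧ (∀ x, 2 ≤ ‖x‖ → f x = 0) ∧
      ∃ G : ℝ, ∀ x, ‖fderiv ℝ f x‖ ≤ G := by
    let f : ContDiffBump (0 : E) := ⟨1, 2, one_pos, one_lt_two⟩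
    have hfc : ContDiff ℝ 1 f := f.contDiff
    exact ⟨f, f.contDiff, fun x => ⟨f.nonneg, f.le_one⟩,
      fun x hx => f.one_of_mem_closedBall (by simpa [f] using hx),
      fun x hx => f.zero_of_le_dist (by simpa [f] using hx),
      (f.hasCompactSupport.fderiv (𝕜 := ℝ)).exists_bound_of_continuous
        (hfc.continuous_fderiv one_ne_zero)⟩
  have hG0 : 0 ≤ G := (norm_nonneg _).trans (hG 0)
  refine ⟨G, hG0, fun N hN => ?_⟩
  have hN' : (0 : ℝ) < N := by exact_mod_cast hN
  have hnorm : ∀ x : E, ‖(N : ℝ)⁻¹ • x‖ = (N : ℝ)⁻¹ * ‖x‖ := fun x => by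
    rw [norm_smul, norm_inv, Real.norm_natCast]
  have h1 : ∀ x : E, ‖x‖ ≤ N → f ((N : ℝ)⁻¹ • x) = 1 := fun x hx => hf1 _ (by
    rw [hnorm, inv_mul_le_iff₀ hN']; simpa using hx)
  have h0 : ∀ x : E, 2 * N ≤ ‖x‖ → f ((N : ℝ)⁻¹ • x) = 0 := fun x hx => hf0 _ (by
    rw [hnorm, le_inv_mul_iff₀ hN']; simpa [mul_comm] using hx)
  refine ⟨fun x => f ((N : ℝ)⁻¹ • x), hfc.comp (contDiff_const_smul _),
    fun x => hf01 _, h1, h0, fun x v => ?_, fun x hx => ?_⟩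
  · have hd : HasFDerivAt (fun x => f ((N : ℝ)⁻¹ • x))
        ((fderiv ℝ f ((N : ℝ)⁻¹ • x)).comp ((N : ℝ)⁻¹ • ContinuousLinearMap.id ℝ E)) x :=
      (hfc.differentiable (by simp) _).hasFDerivAt.comp x
        ((hasFDerivAt_id x).const_smul (N : ℝ)⁻¹)
    have e : fderiv ℝ (fun x => f ((N : ℝ)⁻¹ • x)) x v
        = fderiv ℝ f ((N : ℝ)⁻¹ • x) ((N : ℝ)⁻¹ • v) := by
      rw [hd.fderiv]; rfl
    rw [e, ← Real.norm_eq_abs, mul_assoc, ← hnorm]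
    exact (ContinuousLinearMap.le_opNorm _ _).trans
      (mul_le_mul_of_nonneg_right (hG _) (norm_nonneg _))
  -- Where the cutoff equals 1 or 0 it has a global extremum, so its derivative vanishes also on the
  -- two boundary spheres of the shell.
  · rw [not_and_or, not_lt, not_lt] at hx
    rcases hx with hx | hx
    · refine IsLocalMax.fderiv_eq_zero (Eventually.of_forall fun y => ?_)
      beta_reduce
      rw [h1 x hx]
      exact (hf01 _).2
    · refine IsLocalMin.fderiv_eq_zero (Eventually.of_forall fun y => ?_)
      beta_reduce
      rw [h0 x hx]
      exact (hf01 _).1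

/-- The pointwise inequality behind the gradient bound for a vector field cut off by `s e ^ 2`. -/
theorem cutoff_lyapunov_inequality {s e n Q X V G C δ I₁ I₂ I₃ : ℝ} (hs0 : 0 ≤ s) (hs1 : s ≤ 1)
    (he0 : 0 ≤ e) (he1 : e ≤ 1) (hX : 0 ≤ X) (hV : 0 ≤ V) (hC : 0 ≤ C) (hδ : 0 < δ)
    (h₁ : I₁ ≤ Q * X) (h₂ : I₂ ≤ G * X * n) (h₃ : I₃ ≤ (C - δ * n ^ 2 - 2 * Q) * V) :
    2 * (s * (e ^ 2 * I₁ + 2 * e * I₂)) * V + X * (s * e ^ 2 * I₃)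
      ≤ (C + 4 * G ^ 2 / δ) * (X * V) := by
  -- Completing the square. Differentiating `e ^ 2` leaves a factor `e` in the cross term, which is
  -- why a square can absorb it into `δ * e ^ 2 * n ^ 2`.
  have hq : 4 * e * G * n ≤ δ * e ^ 2 * n ^ 2 + 4 * G ^ 2 / δ := by
    have h : 0 ≤ (δ * e * n - 2 * G) ^ 2 / δ := by positivity
    have h' : (δ * e * n - 2 * G) ^ 2 / δ = δ * e ^ 2 * n ^ 2 - 4 * e * G * n + 4 * G ^ 2 / δ := by
      field_simp; ring
    linarith
  calc 2 * (s * (e ^ 2 * I₁ + 2 * e * I₂)) * V + X * (s * e ^ 2 * I₃)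
      ≤ 2 * (s * (e ^ 2 * (Q * X) + 2 * e * (G * X * n))) * V
        + X * (s * e ^ 2 * ((C - δ * n ^ 2 - 2 * Q) * V)) := by gcongr
    _ = s * (X * V) * (4 * e * G * n - δ * e ^ 2 * n ^ 2 + e ^ 2 * C) := by ring
    _ ≤ s * (X * V) * (4 * G ^ 2 / δ + 1 * C) := by
        gcongr
        · linarith
        · exact pow_le_one₀ he0 he1
    _ ≤ 1 * (X * V) * (4 * G ^ 2 / δ + 1 * C) := by gcongr
    _ = _ := by ring

/-- Interpolating with a bump between `V` and its lower bound `c` extends the weight to the whole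
space and keeps the lower bound. -/
theorem exists_global_weight {r r₁ c : ℝ} (hr₁ : 0 < r₁) (hr : r₁ < r) {V : E → ℝ}
    (hV : ContDiffOn ℝ 1 V (Metric.ball 0 r)) (hc : ∀ x ∈ Metric.ball 0 r, c ≤ V x) :
    ∃ W : E → ℝ, ContDiff ℝ 1 W ∧ (∀ x, c ≤ W x) ∧
      ∀ x ∈ Metric.closedBall 0 r₁, W =ᶠ[𝓝 x] V := by
  let χ : ContDiffBump (0 : E) := ⟨(2 * r₁ + r) / 3, (r₁ + 2 * r) / 3, by linarith, by linarith⟩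
  have hχs : tsupport χ ⊆ Metric.ball 0 r := by
    rw [χ.tsupport_eq]
    exact Metric.closedBall_subset_ball (show (r₁ + 2 * r) / 3 < r by linarith)
  refine ⟨fun x => χ x • (V x - c) + c, (contDiff_smul_of_tsupport_subset Metric.isOpen_ball
    χ.contDiff hχs (hV.sub contDiffOn_const)).add contDiff_const, fun x => ?_, fun x hx => ?_⟩
  · by_cases h : x ∈ Metric.ball 0 r
    · have := mul_nonneg (χ.nonneg (x := x)) (sub_nonneg.2 (hc x h))
      simp only [smul_eq_mul]
      linarith
    · have : χ x = 0 := image_eq_zero_of_notMem_tsupport fun h' => h (hχs h')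
      simp [this]
  · have hx' : x ∈ Metric.ball 0 χ.rIn :=
      Metric.closedBall_subset_ball (show r₁ < (2 * r₁ + r) / 3 by linarith) hx
    filter_upwards [χ.eventuallyEq_one_of_mem_ball hx'] with y hy
    simp [hy]

end Cutoff

/-! ### The Lyapunov condition for the cut off field -/

section TestFunctions

variable {d : ℕ}

local notation "𝔼" => EuclideanSpace ℝ (Fin d)

theorem inner_apply_le_maxQuadForm (A : 𝔼 →L[ℝ] 𝔼) (ξ : 𝔼) :
    inner ℝ (A ξ) ξ ≤ maxQuadForm A * ‖ξ‖ ^ 2 := by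
  by_cases hξ : ξ = 0
  · simp [hξ]
  have hn : 0 < ‖ξ‖ := norm_pos_iff.2 hξ
  have hbdd : BddAbove ((fun ξ => inner ℝ (A ξ) ξ) '' Metric.sphere (0 : 𝔼) 1) :=
    ((isCompact_sphere (0 : 𝔼) 1).image (by fun_prop)).bddAbove
  have h := le_csSup hbdd ⟨‖ξ‖⁻¹ • ξ, by simp [norm_smul, hn.ne'], rfl⟩
  have e : inner ℝ (A (‖ξ‖⁻¹ • ξ)) (‖ξ‖⁻¹ • ξ) = (‖ξ‖ ^ 2)⁻¹ * inner ℝ (A ξ) ξ := by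
    rw [map_smul, real_inner_smul_left, real_inner_smul_right]
    field_simp
  beta_reduce at h
  rw [e, inv_mul_le_iff₀ (by positivity), mul_comm] at h
  exact h

/-- The gradient condition is preserved, with a different constant, by cutting off the field. -/
theorem cutoff_field_lyapunov {r T : ℝ} {η : 𝔼 → ℝ} (hη : ContDiff ℝ 1 η)
    (hη01 : ∀ x, 0 ≤ η x ∧ η x ≤ 1) {G₁ : ℝ} (hG₁ : ∀ x, ‖fderiv ℝ η x‖ ≤ G₁)
    (hηs : tsupport η ⊆ Metric.ball 0 r) {β : 𝔼 → ℝ → 𝔼}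
    (hβ : ContDiffOn ℝ ∞ (fun p : 𝔼 × ℝ => β p.1 p.2) (Metric.ball 0 r ×ˢ univ))
    {V W : 𝔼 → ℝ} {c C δ : ℝ} (hc : 0 < c) (hC : 0 < C) (hδ : 0 < δ)
    (hWc : ∀ x, c ≤ W x) (hWV : ∀ x ∈ tsupport η, W =ᶠ[𝓝 x] V)
    (hineq : ∀ x ∈ Metric.ball 0 r, ∀ t ∈ Icc 0 T, inner ℝ (β x t) (gradient V x) ≤
      (C - δ * ‖β x t‖ ^ 2 - 2 * maxQuadForm (fderiv ℝ (fun y => β y t) x)) * V x)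
    {θ : ℝ → ℝ} (hθ01 : ∀ t, 0 ≤ θ t ∧ θ t ≤ 1) (hθ : ∀ t, T ≤ t → θ t = 0) (x : 𝔼) {t : ℝ}
    (ht : 0 ≤ t) (ξ : 𝔼) :
    2 * inner ℝ (fderiv ℝ (fun y => θ t • (η y ^ 2 • β y t)) x ξ) ξ * W x
      + ‖ξ‖ ^ 2 * fderiv ℝ W x (θ t • (η x ^ 2 • β x t))
      ≤ (C + 4 * G₁ ^ 2 / δ) * (‖ξ‖ ^ 2 * W x) := by
  have hW0 : 0 ≤ W x := hc.le.trans (hWc x)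
  -- Off the support of `η`, or at times `t ≥ T`, the field vanishes near `x` and the inequality is
  -- trivial. Otherwise `W = V` near `x`, so their gradients agree too.
  by_cases hx : x ∈ tsupport η
  swap
  · have hz := notMem_tsupport_iff_eventuallyEq.1 hx
    have h1 : (fun y => θ t • (η y ^ 2 • β y t)) =ᶠ[𝓝 x] fun _ => 0 := by
      filter_upwards [hz] with y hy
      simp [hy]
    rw [h1.fderiv_eq, hz.self_of_nhds]
    simp only [fderiv_fun_const, Pi.zero_apply]
    simp
    positivity
  by_cases htT : T ≤ t
  · simp [hθ t htT]
    positivity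
  push Not at htT
  have hxU := hηs hx
  have hβd : DifferentiableAt ℝ (fun y => β y t) x := by
    have h1 : ContDiffAt ℝ ∞ (fun p : 𝔼 × ℝ => β p.1 p.2) (x, t) :=
      hβ.contDiffAt ((Metric.isOpen_ball.prod isOpen_univ).mem_nhds ⟨hxU, trivial⟩)
    exact (HasFDerivAt.comp (g := fun p : 𝔼 × ℝ => β p.1 p.2) (f := fun y => (y, t)) x
      (h1.differentiableAt (by simp)).hasFDerivAt
      ((hasFDerivAt_id x).prodMk (hasFDerivAt_const t x))).differentiableAt
  have hηd := (hη.differentiable one_ne_zero x).hasFDerivAt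
  have hd := ((hηd.pow 2).smul hβd.hasFDerivAt).const_smul (θ t)
  have hd' : HasFDerivAt (fun y => θ t • (η y ^ 2 • β y t)) _ x := hd
  rw [hd'.fderiv, (hWV x hx).fderiv_eq, (hWV x hx).self_of_nhds]
  have hVg : fderiv ℝ V x (β x t) = inner ℝ (β x t) (gradient V x) := by
    rw [real_inner_comm, gradient, InnerProductSpace.toDual_symm_apply]
  have h2 : fderiv ℝ η x ξ * inner ℝ (β x t) ξ ≤ G₁ * ‖ξ‖ ^ 2 * ‖β x t‖ := by
    refine (le_abs_self _).trans ?_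
    rw [abs_mul]
    calc _ ≤ (G₁ * ‖ξ‖) * (‖β x t‖ * ‖ξ‖) := by
          refine mul_le_mul ?_ (abs_real_inner_le_norm _ _) (abs_nonneg _) ?_
          · exact (ContinuousLinearMap.le_opNorm _ _).trans (mul_le_mul_of_nonneg_right (hG₁ x) (norm_nonneg _))
          · exact mul_nonneg ((norm_nonneg _).trans (hG₁ x)) (norm_nonneg _)
      _ = _ := by ring
  have key := cutoff_lyapunov_inequality (s := θ t) (e := η x) (X := ‖ξ‖ ^ 2) (V := V x)
    (hθ01 t).1 (hθ01 t).2 (hη01 x).1 (hη01 x).2 (by positivity)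
    (by rw [← (hWV x hx).self_of_nhds]; exact hW0) hC.le hδ
    (inner_apply_le_maxQuadForm (fderiv ℝ (fun y => β y t) x) ξ) h2
    (hineq x hxU t ⟨ht, htT.le⟩)
  refine le_trans (le_of_eq ?_) key
  rw [map_smul, map_smul, hVg]
  simp [inner_add_left, real_inner_smul_left]
  ring

end TestFunctions

/-! ### Construction of the test functions -/

section TestFunctionConstruction

variable {d : ℕ}

local notation "𝔼" => EuclideanSpace ℝ (Fin d)

/-- As `f` has zero derivative along `(α, 1)`, only the mismatch `v - α` of the drifts reaches `f`.
-/
theorem fderiv_cutoff_transport_apply {E : Type*} [NormedAddCommGroup E] [NormedSpace ℝ E]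
    {φ : E → ℝ} {f u : E × ℝ → ℝ} {x : E} {t : ℝ} (hφ : DifferentiableAt ℝ φ x)
    (hf : DifferentiableAt ℝ f (x, t)) (hu : u =ᶠ[𝓝 (x, t)] fun p => φ p.1 * f p) {α : E}
    (hα : fderiv ℝ f (x, t) (α, 1) = 0) (v : E) :
    fderiv ℝ u (x, t) (v, 1)
      = φ x * fderiv ℝ f (x, t) (v - α, 0) + f (x, t) * fderiv ℝ φ x v := by
  have h : HasFDerivAt (fun p : E × ℝ => φ p.1 * f p)
      (φ x • fderiv ℝ f (x, t)
        + f (x, t) • (fderiv ℝ φ x).comp (ContinuousLinearMap.fst ℝ E ℝ)) (x, t) :=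
    (HasFDerivAt.comp (g := φ) (f := Prod.fst) (x, t) hφ.hasFDerivAt hasFDerivAt_fst).mul
      hf.hasFDerivAt
  have e : fderiv ℝ f (x, t) (v, 1) = fderiv ℝ f (x, t) (v - α, 0) := by
    have := map_add (fderiv ℝ f (x, t)) (v - α, 0) (α, 1)
    rwa [hα, add_zero, Prod.mk_add_mk, sub_add_cancel, zero_add] at this
  rw [hu.fderiv_eq, h.fderiv, ← e]
  simp

theorem exists_time_cutoff {T : ℝ} (hT : 0 < T) :
    ∃ (τ : ℝ → ℝ) (I : Set ℝ), ContDiff ℝ ∞ τ ∧ IsCompact I ∧ I ⊆ Ioo (-1) (T + 1) ∧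
      (∀ t, 0 ≤ τ t ∧ τ t ≤ 1) ∧ (∀ t ∈ Icc 0 T, τ =ᶠ[𝓝 t] 1) ∧ ∀ t ∉ I, τ t = 0 := by
  let τ : ContDiffBump (T / 2 : ℝ) := ⟨T / 2 + 1 / 4, T / 2 + 1 / 2, by linarith, by linarith⟩
  refine ⟨τ, Metric.closedBall (T / 2) (T / 2 + 1 / 2), τ.contDiff, isCompact_closedBall _ _, ?_,
    fun t => ⟨τ.nonneg, τ.le_one⟩, fun t ht => ?_, fun t ht => ?_⟩
  · rw [Real.closedBall_eq_Icc]
    exact Icc_subset_Ioo (by linarith) (by linarith)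
  · refine τ.eventuallyEq_one_of_mem_ball ?_
    change t ∈ Metric.ball (T / 2) (T / 2 + 1 / 4)
    rw [Real.ball_eq_Ioo]
    exact ⟨by linarith [ht.1], by linarith [ht.2]⟩
  · exact τ.zero_of_le_dist (not_le.1 ht).le

theorem exists_smooth_step {q q' : ℝ} (h : q < q') :
    ∃ θ : ℝ → ℝ, ContDiff ℝ ∞ θ ∧ (∀ t, 0 ≤ θ t ∧ θ t ≤ 1) ∧
      (∀ t ≤ q, θ t = 1) ∧ ∀ t, q' ≤ t → θ t = 0 := by
  have hq : 0 < q' - q := sub_pos.2 h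
  refine ⟨fun t => Real.smoothTransition ((q' - t) / (q' - q)),
    Real.smoothTransition.contDiff.comp ((contDiff_const.sub contDiff_id).div_const _),
    fun t => ⟨Real.smoothTransition.nonneg _, Real.smoothTransition.le_one _⟩,
    fun t ht => Real.smoothTransition.one_of_one_le ?_,
    fun t ht => Real.smoothTransition.zero_of_nonpos ?_⟩
  · rw [le_div_iff₀ hq]; linarith
  · exact div_nonpos_of_nonpos_of_nonneg (by linarith) hq.le

/-- A product of space and time cutoffs times a field smooth on an open set is smooth and compactly
supported. -/
theorem cutoff_smul_contDiff {E G : Type*} [NormedAddCommGroup E] [NormedSpace ℝ E]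
    [NormedAddCommGroup G] [NormedSpace ℝ G] {n : WithTop ℕ∞} {χ : ℝ → ℝ} {ρ : E → ℝ} {K : Set E}
    {I : Set ℝ} (hK : IsCompact K) (hI : IsCompact I) (hχ : ContDiff ℝ n χ) (hρ : ContDiff ℝ n ρ)
    (hχ0 : ∀ t ∉ I, χ t = 0) (hρ0 : ∀ x ∉ K, ρ x = 0) {U : Set E} {J : Set ℝ} (hU : IsOpen U)
    (hJ : IsOpen J) (hKU : K ⊆ U) (hIJ : I ⊆ J) {h : E × ℝ → G} (hh : ContDiffOn ℝ n h (U ×ˢ J)) :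
    ContDiff ℝ n (fun p : E × ℝ => (χ p.2 * ρ p.1) • h p) ∧
      HasCompactSupport fun p : E × ℝ => (χ p.2 * ρ p.1) • h p := by
  have hc : IsCompact (K ×ˢ I) := hK.prod hI
  have hz : ∀ p ∉ K ×ˢ I, χ p.2 * ρ p.1 = 0 := by
    intro p hp
    rw [mem_prod, not_and_or] at hp
    rcases hp with hp | hp
    · rw [hρ0 _ hp, mul_zero]
    · rw [hχ0 _ hp, zero_mul]
  have hs : tsupport (fun p : E × ℝ => χ p.2 * ρ p.1) ⊆ K ×ˢ I :=
    closure_minimal (fun p hp => by by_contra h; exact hp (hz p h)) hc.isClosed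
  refine ⟨contDiff_smul_of_tsupport_subset (hU.prod hJ)
    ((hχ.comp contDiff_snd).mul (hρ.comp contDiff_fst)) (hs.trans (prod_mono hKU hIJ)) hh, ?_⟩
  exact HasCompactSupport.intro hc fun p hp => by rw [hz p hp, zero_smul]

/-- Test functions, compactly supported in space-time, that solve the transport equation of the
cut off field `β` up to time `q` and are close to `φ * ψ` at times close to `q'`. -/
theorem exists_test_function {T r₀ r₁ r : ℝ} (hT : 0 < T) (hr₁ : 0 < r₁) (hr₀₁ : r₀ ≤ r₁)
    (hr₁r : r₁ < r) {η : 𝔼 → ℝ} (hη : ContDiff ℝ ∞ η) (hη01 : ∀ x, 0 ≤ η x ∧ η x ≤ 1)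
    (hη1 : ∀ x, ‖x‖ ≤ r₀ → η x = 1) (hη0 : ∀ x, r₁ ≤ ‖x‖ → η x = 0) {G₁ : ℝ}
    (hG₁ : ∀ x, ‖fderiv ℝ η x‖ ≤ G₁) {β : 𝔼 → ℝ → 𝔼}
    (hβ : ContDiffOn ℝ ∞ (fun p : 𝔼 × ℝ => β p.1 p.2) (Metric.ball 0 r ×ˢ univ))
    {V : 𝔼 → ℝ} (hV : ContDiffOn ℝ 1 V (Metric.ball 0 r)) {c C δ : ℝ} (hc : 0 < c) (hC : 0 < C)
    (hδ : 0 < δ) (hVc : ∀ x ∈ Metric.ball 0 r, c ≤ V x)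
    (hineq : ∀ x ∈ Metric.ball 0 r, ∀ t ∈ Icc 0 T, inner ℝ (β x t) (gradient V x) ≤
      (C - δ * ‖β x t‖ ^ 2 - 2 * maxQuadForm (fderiv ℝ (fun y => β y t) x)) * V x)
    {φ : 𝔼 → ℝ} (hφ : ContDiff ℝ ∞ φ) (hφ01 : ∀ x, 0 ≤ φ x ∧ φ x ≤ 1)
    (hφ0 : ∀ x, r₀ ≤ ‖x‖ → φ x = 0) {ψ : 𝔼 → ℝ} (hψ : ContDiff ℝ 1 ψ) {L B : ℝ}
    (hL : ∀ x, ‖fderiv ℝ ψ x‖ ≤ L) (hB : ∀ x, |ψ x| ≤ B) :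
    ∃ M : ℝ, 0 ≤ M ∧ ∀ q q' : ℝ, q < q' → q' ≤ T → ∃ u : 𝔼 × ℝ → ℝ,
      ContDiff ℝ 1 u ∧ HasCompactSupport u ∧ ∀ x, ∀ t ∈ Icc 0 T, t ≤ q →
        |u (x, t) - φ x * ψ x| ≤ L * (M * (q' - t)) ∧ (φ x = 0 → u (x, t) = 0) ∧
        ∀ v, |fderiv ℝ u (x, t) (v, 1)| ≤
          φ x * (L * Real.sqrt (Real.exp ((C + 4 * G₁ ^ 2 / δ) * (T + 1)) / c)
            * (Real.sqrt (V x) * ‖β x t - v‖)) + B * |fderiv ℝ φ x v| := by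
  have hηs : tsupport η ⊆ Metric.closedBall 0 r₁ := by
    refine closure_minimal (fun x hx => ?_) Metric.isClosed_closedBall
    rw [mem_closedBall_zero_iff]
    by_contra h
    exact hx (hη0 x (not_le.1 h).le)
  have hηs' : tsupport η ⊆ Metric.ball 0 r := hηs.trans (Metric.closedBall_subset_ball hr₁r)
  have hηz : ∀ x ∉ Metric.closedBall (0 : 𝔼) r₁, η x ^ 2 = 0 := fun x hx => by
    rw [image_eq_zero_of_notMem_tsupport fun h => hx (hηs h), zero_pow two_ne_zero]
  obtain ⟨τ, I, hτ, hIc, hII, hτ01, hτ1, hτ0⟩ := exists_time_cutoff hT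
  have hfield : ∀ θ : ℝ → ℝ, ContDiff ℝ ∞ θ →
      ContDiff ℝ ∞ (fun p : 𝔼 × ℝ => (θ p.2 * τ p.2 * η p.1 ^ 2) • β p.1 p.2) ∧
      HasCompactSupport (fun p : 𝔼 × ℝ => (θ p.2 * τ p.2 * η p.1 ^ 2) • β p.1 p.2) :=
    fun θ hθ => cutoff_smul_contDiff (χ := fun t => θ t * τ t) (ρ := fun x => η x ^ 2)
      (isCompact_closedBall (0 : 𝔼) r₁) hIc (hθ.mul hτ) (hη.pow 2)
      (fun t ht => by rw [hτ0 t ht, mul_zero]) hηz Metric.isOpen_ball isOpen_univ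
      (Metric.closedBall_subset_ball hr₁r) (subset_univ _) hβ
  -- `M` bounds the field before it is switched off, hence depends neither on `q` nor on `q'`; this
  -- makes the error `L * (M * (q' - t))` small.
  obtain ⟨hf1c, hf1s⟩ := hfield (fun _ => 1) contDiff_const
  obtain ⟨M, hM⟩ := hf1s.exists_bound_of_continuous hf1c.continuous
  refine ⟨M, (norm_nonneg _).trans (hM 0), fun q q' hqq' hq'T => ?_⟩
  obtain ⟨θ, hθ, hθ01, hθ1, hθ0⟩ := exists_smooth_step hqq'
  obtain ⟨hac, has⟩ := hfield θ hθ
  -- For `t ≤ q` in `[0, T]` and `‖x‖ ≤ r₀` all three cutoffs equal 1, so `a` is `β` wherever `φ` is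
  -- nonzero; after `q'` the field is zero.
  set a : 𝔼 × ℝ → 𝔼 := fun p => (θ p.2 * τ p.2 * η p.1 ^ 2) • β p.1 p.2 with ha
  have haM : ∀ p, ‖a p‖ ≤ M := fun p => by
    refine le_trans ?_ (hM p)
    have : a p = θ p.2 • ((1 * τ p.2 * η p.1 ^ 2) • β p.1 p.2) := by
      simp only [ha, smul_smul]; congr 1; ring
    rw [this, norm_smul, Real.norm_of_nonneg (hθ01 _).1]
    exact mul_le_of_le_one_left (norm_nonneg _) (hθ01 _).2
  obtain ⟨W, hW, hWc, hWV⟩ := exists_global_weight hr₁ hr₁r hV hVc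
  have hΓ : 0 ≤ C + 4 * G₁ ^ 2 / δ := by positivity
  obtain ⟨f, Y, hf, hfY⟩ := exists_transport_solution (hac.of_le (by norm_cast)) has haM hT
    (q := q') (fun x t ht => by simp [ha, hθ0 t ht]) hψ hL hW hc hWc hΓ (fun x t ht ξ => by
      rw [fderiv_apply_inl_eq (hac.differentiable (by simp) _)]
      have := cutoff_field_lyapunov (hη.of_le (by simp)) hη01 hG₁ hηs' hβ hc hC hδ hWc
        (fun x hx => hWV x (hηs hx)) hineq (θ := fun t => θ t * τ t)
        (fun t => ⟨mul_nonneg (hθ01 t).1 (hτ01 t).1,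
          mul_le_one₀ (hθ01 t).2 (hτ01 t).1 (hτ01 t).2⟩)
        (fun t ht => by rw [hθ0 t (hq'T.trans ht), zero_mul]) x ht ξ
      simpa only [ha, smul_smul] using this)
  obtain ⟨hu1, hu2⟩ := cutoff_smul_contDiff (χ := τ) (ρ := φ) (isCompact_closedBall (0 : 𝔼) r₁) hIc
    (hτ.of_le (by simp)) (hφ.of_le (by simp)) hτ0
    (fun x hx => hφ0 x (hr₀₁.trans (by
      rw [mem_closedBall_zero_iff, not_le] at hx; exact hx.le)))
    isOpen_univ isOpen_Ioo (subset_univ _) hII hf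
  refine ⟨fun p => (τ p.2 * φ p.1) • f p, hu1, hu2, fun x t ht htq => ?_⟩
  obtain ⟨h1, h2, h3, h4⟩ := hfY x t ht
  have hτt : τ t = 1 := (hτ1 t ht).self_of_nhds
  refine ⟨?_, fun h => by simp [h], fun v => ?_⟩
  · have hψY := norm_sub_le_of_norm_fderiv_le hψ hL x (Y x t)
    have hL0 : 0 ≤ L := (norm_nonneg _).trans (hL 0)
    rw [max_eq_left (by linarith)] at h2
    change |(τ t * φ x) • f (x, t) - φ x * ψ x| ≤ _
    rw [hτt, one_mul, h1, smul_eq_mul, ← mul_sub, abs_mul, abs_of_nonneg (hφ01 x).1]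
    refine (mul_le_of_le_one_left (abs_nonneg _) (hφ01 x).2).trans (hψY.trans ?_)
    gcongr
  · have hfd : DifferentiableAt ℝ f (x, t) := (hf.contDiffAt ((isOpen_univ.prod isOpen_Ioo).mem_nhds
      ⟨trivial, by linarith [ht.1], by linarith [ht.2]⟩)).differentiableAt one_ne_zero
    have hu : (fun p : 𝔼 × ℝ => (τ p.2 * φ p.1) • f p) =ᶠ[𝓝 (x, t)] fun p => φ p.1 * f p := by
      have := (continuous_snd.tendsto ((x, t) : 𝔼 × ℝ)).eventually (hτ1 t ht)
      filter_upwards [this] with p hp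
      simp only [hp, smul_eq_mul, Pi.one_apply, one_mul]
    rw [fderiv_cutoff_transport_apply (hφ.differentiable (by simp) x) hfd hu h3 v]
    refine (abs_add_le _ _).trans (add_le_add ?_ ?_)
    · rw [abs_mul, abs_of_nonneg (hφ01 x).1]
      by_cases hx : r₀ ≤ ‖x‖
      · simp [hφ0 x hx]
      push Not at hx
      have hax : a (x, t) = β x t := by
        simp [ha, hτt, hθ1 t htq, hη1 x hx.le]
      have hWx : W x = V x := (hWV x (by
        rw [mem_closedBall_zero_iff]; exact hx.le.trans hr₀₁)).self_of_nhds
      have := h4 (v - a (x, t))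
      rw [hWx, hax, norm_sub_rev, mul_assoc _ (Real.sqrt (V x))] at this
      rw [hax]
      exact mul_le_mul_of_nonneg_left this (hφ01 x).1
    · rw [abs_mul, h1]
      exact mul_le_mul_of_nonneg_right (hB _) (abs_nonneg _)

end TestFunctionConstruction

/-! ### The main estimate and the two limits -/

section Uniqueness

open LocBddMeasure

variable {d : ℕ}

local notation "𝔼" => EuclideanSpace ℝ (Fin d)

theorem enorm_integral_le_add (m : LocBddMeasure 𝔼) {f g : 𝔼 → ℝ} (hf : Integrable f m.variation)
    (hg : Integrable g m.variation) :
    ‖m.integral f‖ₑ ≤ ∫⁻ x, ‖g x - f x‖ₑ ∂m.variation + ‖m.integral g‖ₑ := by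
  have e : m.integral f = m.integral g - m.integral fun x => g x - f x := by
    simp only [LocBddMeasure.integral]
    rw [integral_sub (hg.mono_measure m.posPart_le_variation)
        (hf.mono_measure m.posPart_le_variation),
      integral_sub (hg.mono_measure m.negPart_le_variation)
        (hf.mono_measure m.negPart_le_variation)]
    ring
  rw [e, add_comm]
  exact enorm_sub_le.trans (add_le_add le_rfl (m.enorm_integral_le _))

theorem le_of_forall_pos_le_mul_add {a v e : ℝ≥0∞} {K : ℝ} (hv : v ≠ ⊤)
    (h : ∀ ε : ℝ, 0 < ε → a ≤ ENNReal.ofReal (K * ε) * v + e) : a ≤ e := by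
  have ht : Tendsto (fun ε : ℝ => ENNReal.ofReal (K * ε) * v + e) (𝓝[>] 0) (𝓝 (0 * v + e)) := by
    refine Tendsto.add (ENNReal.Tendsto.mul_const ?_ (Or.inr hv)) tendsto_const_nhds
    have : Continuous fun ε : ℝ => ENNReal.ofReal (K * ε) :=
      ENNReal.continuous_ofReal.comp (continuous_const.mul continuous_id)
    simpa using (this.tendsto 0).mono_left nhdsWithin_le_nhds
  rw [zero_mul, zero_add] at ht
  exact ge_of_tendsto ht (eventually_mem_nhdsWithin.mono fun ε hε => h ε hε)

/-- Integration in time of the equation against a test function. -/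
theorem enorm_integral_test_le {T : ℝ} {b : 𝔼 → ℝ → 𝔼}
    (hb : Measurable fun p : 𝔼 × ℝ => b p.1 p.2) {n : ℝ → LocBddMeasure 𝔼}
    (hn : MeasurableFamily n) {u : 𝔼 × ℝ → ℝ} {t : ℝ} (ht : t ∈ Icc 0 T)
    (heq : (n t).integral (fun x => u (x, t)) =
      ∫ s in (0 : ℝ)..t, (n s).integral fun x => fderiv ℝ u (x, s) (b x s, 1))
    {Λ Θ : ℝ} {S A : Set 𝔼} (hS : MeasurableSet S) (hA : MeasurableSet A) {β : 𝔼 → ℝ → 𝔼}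
    {V : 𝔼 → ℝ}
    (hu : ∀ x, ∀ s ∈ Icc 0 t, ‖fderiv ℝ u (x, s) (b x s, 1)‖ₑ ≤
      ENNReal.ofReal Λ * S.indicator (fun x => ‖Real.sqrt (V x) • (β x s - b x s)‖ₑ) x +
      ENNReal.ofReal Θ * A.indicator (fun x => ‖b x s‖ₑ) x) :
    ‖(n t).integral fun x => u (x, t)‖ₑ ≤
      (ENNReal.ofReal Λ * ∫⁻ s in Icc 0 T, ∫⁻ x in S,
        ‖Real.sqrt (V x) • (β x s - b x s)‖ₑ ∂(n s).variation) +
      ENNReal.ofReal Θ * ∫⁻ s in Icc 0 T, ∫⁻ x in A, ‖b x s‖ₑ ∂(n s).variation := by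
  have hbm : Measurable fun p : 𝔼 × ℝ => A.indicator (fun x => ‖b x p.2‖ₑ) p.1 := by
    have : (fun p : 𝔼 × ℝ => A.indicator (fun x => ‖b x p.2‖ₑ) p.1)
        = (Prod.fst ⁻¹' A).indicator fun p : 𝔼 × ℝ => ‖b p.1 p.2‖ₑ := by
      funext p
      by_cases hp : p.1 ∈ A
      · rw [indicator_of_mem hp, indicator_of_mem (by exact hp)]
      · rw [indicator_of_notMem hp, indicator_of_notMem (by exact hp)]
    rw [this]
    exact hb.enorm.indicator (measurable_fst hA)
  have hslice : ∀ s ∈ Icc 0 t, ‖(n s).integral fun x => fderiv ℝ u (x, s) (b x s, 1)‖ₑ ≤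
      ENNReal.ofReal Λ * ∫⁻ x in S, ‖Real.sqrt (V x) • (β x s - b x s)‖ₑ ∂(n s).variation +
      ENNReal.ofReal Θ * ∫⁻ x in A, ‖b x s‖ₑ ∂(n s).variation := by
    intro s hs
    refine ((n s).enorm_integral_le _).trans ((lintegral_mono fun x => hu x s hs).trans ?_)
    have hbs : Measurable fun x => A.indicator (fun x => ‖b x s‖ₑ) x :=
      hbm.comp measurable_prodMk_right
    -- Nothing is known about the measurability of `β` and `V`, but the lower integral is additive
    -- as soon as one summand, here the one with `b`, is measurable.
    rw [lintegral_add_right _ (hbs.const_mul _), lintegral_const_mul' _ _ ENNReal.ofReal_ne_top,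
      lintegral_const_mul' _ _ ENNReal.ofReal_ne_top, lintegral_indicator hS,
      lintegral_indicator hA]
  have hmA : Measurable fun s => ∫⁻ x in A, ‖b x s‖ₑ ∂(n s).variation := by
    have := hn.measurable_lintegral_variation hbm
    simpa only [lintegral_indicator hA] using this
  rw [heq, intervalIntegral.integral_of_le ht.1]
  refine (enorm_integral_le_lintegral_enorm _).trans ?_
  refine (setLIntegral_mono' measurableSet_Ioc fun s hs => hslice s ⟨hs.1.le, hs.2⟩).trans ?_
  refine (lintegral_mono_set (Ioc_subset_Icc_self.trans (Icc_subset_Icc_right ht.2))).trans ?_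
  rw [lintegral_add_right _ (hmA.const_mul _), lintegral_const_mul' _ _ ENNReal.ofReal_ne_top,
    lintegral_const_mul' _ _ ENNReal.ofReal_ne_top]

/-- The duality estimate for a single approximating field. The first term measures how far `β` is
from `b`, the second is the cost of cutting off at infinity; only the first carries the constants
`C`, `δ`, `c`. -/
theorem ae_enorm_integral_le {T r₀ r₁ r : ℝ} (hT : 0 < T) (hr₁ : 0 < r₁) (hr₀₁ : r₀ ≤ r₁)
    (hr₁r : r₁ < r) {η : 𝔼 → ℝ} (hη : ContDiff ℝ ∞ η) (hη01 : ∀ x, 0 ≤ η x ∧ η x ≤ 1)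
    (hη1 : ∀ x, ‖x‖ ≤ r₀ → η x = 1) (hη0 : ∀ x, r₁ ≤ ‖x‖ → η x = 0) {G₁ : ℝ}
    (hG₁ : ∀ x, ‖fderiv ℝ η x‖ ≤ G₁) {β : 𝔼 → ℝ → 𝔼}
    (hβ : ContDiffOn ℝ ∞ (fun p : 𝔼 × ℝ => β p.1 p.2) (Metric.ball 0 r ×ˢ univ))
    {V : 𝔼 → ℝ} (hV : ContDiffOn ℝ 1 V (Metric.ball 0 r)) {c C δ : ℝ} (hc : 0 < c) (hC : 0 < C)
    (hδ : 0 < δ) (hVc : ∀ x ∈ Metric.ball 0 r, c ≤ V x)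
    (hineq : ∀ x ∈ Metric.ball 0 r, ∀ t ∈ Icc 0 T, inner ℝ (β x t) (gradient V x) ≤
      (C - δ * ‖β x t‖ ^ 2 - 2 * maxQuadForm (fderiv ℝ (fun y => β y t) x)) * V x)
    {φ : 𝔼 → ℝ} (hφ : ContDiff ℝ ∞ φ) (hφ01 : ∀ x, 0 ≤ φ x ∧ φ x ≤ 1)
    (hφ0 : ∀ x, r₀ ≤ ‖x‖ → φ x = 0) {Θ : ℝ} (hφΘ : ∀ x v, |fderiv ℝ φ x v| ≤ Θ * ‖v‖)
    {A : Set 𝔼} (hA : MeasurableSet A) (hφA : ∀ x ∉ A, fderiv ℝ φ x = 0)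
    {ψ : 𝔼 → ℝ} (hψ : ContDiff ℝ 1 ψ) {L B : ℝ}
    (hL : ∀ x, ‖fderiv ℝ ψ x‖ ≤ L) (hB : ∀ x, |ψ x| ≤ B) (hφψ : ∀ x, φ x * ψ x = ψ x)
    {b : 𝔼 → ℝ → 𝔼} (hb : Measurable fun p : 𝔼 × ℝ => b p.1 p.2) {n : ℝ → LocBddMeasure 𝔼}
    (hn : MeasurableFamily n)
    (heq : ∀ u : 𝔼 × ℝ → ℝ, ContDiff ℝ 1 u → HasCompactSupport u →
      ∀ᵐ t ∂(volume.restrict (Icc 0 T)), (n t).integral (fun x => u (x, t)) =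
        ∫ s in (0 : ℝ)..t, (n s).integral fun x => fderiv ℝ u (x, s) (b x s, 1)) :
    ∀ᵐ t ∂(volume.restrict (Icc 0 T)), ‖(n t).integral ψ‖ₑ ≤
      (ENNReal.ofReal (L * Real.sqrt (Real.exp ((C + 4 * G₁ ^ 2 / δ) * (T + 1)) / c)) *
        ∫⁻ s in Icc 0 T, ∫⁻ x in Metric.ball 0 r,
          ‖Real.sqrt (V x) • (β x s - b x s)‖ₑ ∂(n s).variation) +
      ENNReal.ofReal (B * Θ) * ∫⁻ s in Icc 0 T, ∫⁻ x in A, ‖b x s‖ₑ ∂(n s).variation := by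
  obtain ⟨M, hM0, hM⟩ := exists_test_function hT hr₁ hr₀₁ hr₁r hη hη01 hη1 hη0 hG₁ hβ hV hc hC hδ
    hVc hineq hφ hφ01 hφ0 hψ hL hB
  have hL0 : 0 ≤ L := (norm_nonneg _).trans (hL 0)
  have hB0 : 0 ≤ B := (abs_nonneg _).trans (hB 0)
  set Λ := L * Real.sqrt (Real.exp ((C + 4 * G₁ ^ 2 / δ) * (T + 1)) / c) with hΛ
  have hΛ0 : 0 ≤ Λ := mul_nonneg hL0 (Real.sqrt_nonneg _)
  -- Rational pairs give countably many test functions, hence one null set of times for all of them.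
  choose u hu using fun p : {p : ℚ × ℚ // (p.1 : ℝ) < p.2 ∧ (p.2 : ℝ) ≤ T} =>
    hM p.1.1 p.1.2 p.2.1 p.2.2
  have hall : ∀ᵐ t ∂(volume.restrict (Icc 0 T)), ∀ p, (n t).integral (fun x => u p (x, t)) =
      ∫ s in (0 : ℝ)..t, (n s).integral fun x => fderiv ℝ (u p) (x, s) (b x s, 1) :=
    ae_all_iff.2 fun p => heq (u p) (hu p).1 (hu p).2.1
  have hne : ∀ᵐ t ∂(volume.restrict (Icc 0 T)), t ≠ T :=
    ae_restrict_of_ae (Measure.ae_ne volume T)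
  filter_upwards [hall, hne, ae_restrict_mem measurableSet_Icc] with t hall htT ht
  have htlt : t < T := lt_of_le_of_ne ht.2 htT
  refine le_of_forall_pos_le_mul_add (v := (n t).variation (Metric.ball 0 r)) (K := L * M)
    (variation_ne_top _ Metric.isBounded_ball) fun ε hε => ?_
  -- With `t < q < q' < t + ε` the chosen test function differs from `ψ` at time `t` by at most `L *
  -- M * ε` on the ball and by nothing outside.
  obtain ⟨q, hq1, hq2⟩ := exists_rat_btwn (show t < min T (t + ε) from lt_min htlt (by linarith))
  obtain ⟨q', hq'1, hq'2⟩ := exists_rat_btwn hq2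
  have hq'T : (q' : ℝ) ≤ T := (hq'2.trans_le (min_le_left _ _)).le
  have hq'ε : (q' : ℝ) - t ≤ ε := by
    have := hq'2.trans_le (min_le_right _ _)
    linarith
  obtain ⟨huc, hus, hup⟩ := hu ⟨(q, q'), hq'1, hq'T⟩
  have heqt := hall ⟨(q, q'), hq'1, hq'T⟩
  generalize u ⟨(q, q'), hq'1, hq'T⟩ = w at huc hus hup heqt
  have hφr : ∀ x ∉ Metric.ball (0 : 𝔼) r, φ x = 0 := fun x hx => hφ0 x (by
    rw [mem_ball_zero_iff, not_lt] at hx; linarith)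
  have hψr : ∀ x ∉ Metric.ball (0 : 𝔼) r, ψ x = 0 := fun x hx => by
    rw [← hφψ, hφr x hx, zero_mul]
  have hwr : ∀ x ∉ Metric.ball (0 : 𝔼) r, w (x, t) = 0 := fun x hx =>
    (hup x t ht hq1.le).2.1 (hφr x hx)
  have hwc : Continuous fun x => w (x, t) := huc.continuous.comp (by fun_prop)
  refine (enorm_integral_le_add (n t) (integrable_variation_of_continuous _ hψ.continuous hψr)
    (integrable_variation_of_continuous _ hwc hwr)).trans (add_le_add ?_ ?_)
  · have hle : ∀ x, ‖w (x, t) - ψ x‖ₑ ≤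
        (Metric.ball (0 : 𝔼) r).indicator (fun _ => ENNReal.ofReal (L * M * ε)) x := by
      intro x
      by_cases hx : x ∈ Metric.ball 0 r
      · rw [indicator_of_mem hx, ← ofReal_norm]
        refine ENNReal.ofReal_le_ofReal ?_
        have := (hup x t ht hq1.le).1
        rw [hφψ] at this
        refine this.trans ?_
        rw [mul_assoc]
        gcongr
      · rw [hwr x hx, hψr x hx]
        simp
    refine (lintegral_mono hle).trans (le_of_eq ?_)
    rw [lintegral_indicator Metric.isOpen_ball.measurableSet, setLIntegral_const]
  · refine enorm_integral_test_le hb hn ht heqt Metric.isOpen_ball.measurableSet hA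
      fun x s hs => ?_
    have hs' : s ∈ Icc 0 T := ⟨hs.1, hs.2.trans ht.2⟩
    have hbd := (hup x s hs' (hs.2.trans hq1.le)).2.2 (b x s)
    have hreal : ‖fderiv ℝ w (x, s) (b x s, 1)‖ ≤
        Λ * (Metric.ball (0 : 𝔼) r).indicator
          (fun x => ‖Real.sqrt (V x) • (β x s - b x s)‖) x +
        B * Θ * A.indicator (fun x => ‖b x s‖) x := by
      refine hbd.trans (add_le_add ?_ ?_)
      · by_cases hx : x ∈ Metric.ball 0 r
        · rw [indicator_of_mem hx, norm_smul, Real.norm_of_nonneg (Real.sqrt_nonneg _)]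
          exact mul_le_of_le_one_left (by positivity) (hφ01 x).2
        · rw [hφr x hx, indicator_of_notMem hx]
          simp
      · by_cases hx : x ∈ A
        · rw [indicator_of_mem hx, mul_assoc]
          exact mul_le_mul_of_nonneg_left (hφΘ x _) hB0
        · rw [hφA x hx, indicator_of_notMem hx]
          simp
    rw [← ofReal_norm]
    refine (ENNReal.ofReal_le_ofReal hreal).trans (ENNReal.ofReal_add_le.trans (add_le_add ?_ ?_))
    · rw [ENNReal.ofReal_mul hΛ0]
      gcongr
      by_cases hx : x ∈ Metric.ball 0 r
      · rw [indicator_of_mem hx, indicator_of_mem hx, ofReal_norm]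
      · rw [indicator_of_notMem hx, indicator_of_notMem hx, ENNReal.ofReal_zero]
    · by_cases hx : x ∈ A
      · rw [indicator_of_mem hx, indicator_of_mem hx, ENNReal.ofReal_mul' (norm_nonneg _),
          ofReal_norm]
      · rw [indicator_of_notMem hx, indicator_of_notMem hx, mul_zero, ENNReal.ofReal_zero]
        simp

/-- With `N` fixed, `k → ∞` removes the drift term together with its `N`-dependent constants. What
remains is `B * G` times the quantity in (i), with `B` and `G` independent of `N`. -/
theorem ae_integral_eq_zero {T : ℝ} (hT : 0 < T) {b : 𝔼 → ℝ → 𝔼}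
    (hb : Measurable fun p : 𝔼 × ℝ => b p.1 p.2) {n : ℝ → LocBddMeasure 𝔼}
    (hn : MeasurableFamily n)
    (heq : ∀ u : 𝔼 × ℝ → ℝ, ContDiff ℝ 1 u → HasCompactSupport u →
      ∀ᵐ t ∂(volume.restrict (Icc 0 T)), (n t).integral (fun x => u (x, t)) =
        ∫ s in (0 : ℝ)..t, (n s).integral fun x => fderiv ℝ u (x, s) (b x s, 1))
    (h_i : Tendsto (fun N : ℕ => (N : ℝ≥0∞)⁻¹ *
        ∫⁻ t in Icc 0 T, ∫⁻ x in {x | (N : ℝ) < ‖x‖ ∧ ‖x‖ < 2 * N}, ‖b x t‖ₑ ∂(n t).variation)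
      atTop (𝓝 0))
    (h_ii_iii : ∀ r : ℝ, 0 < r →
      ∃ C : ℝ, 0 < C ∧ ∃ δ : ℝ, 0 < δ ∧
      ∃ (bk : ℕ → 𝔼 → ℝ → 𝔼) (V : ℕ → 𝔼 → ℝ),
        (∀ k, ContDiffOn ℝ ∞ (fun p : 𝔼 × ℝ => bk k p.1 p.2) (Metric.ball 0 r ×ˢ univ)) ∧
        (∀ k, ContDiffOn ℝ 1 (V k) (Metric.ball 0 r)) ∧
        (∃ c : ℝ, 0 < c ∧ ∀ k, ∀ x ∈ Metric.ball 0 r, c ≤ V k x) ∧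
        (∀ k, ∀ x ∈ Metric.ball 0 r, ∀ t ∈ Icc 0 T,
          inner ℝ (bk k x t) (gradient (V k) x) ≤
            (C - δ * ‖bk k x t‖ ^ 2 - 2 * maxQuadForm (fderiv ℝ (fun y => bk k y t) x))
              * V k x) ∧
        Tendsto (fun k => ∫⁻ t in Icc 0 T, ∫⁻ x in Metric.ball 0 r,
            ‖(Real.sqrt (V k x)) • (bk k x t - b x t)‖ₑ ∂(n t).variation)
          atTop (𝓝 0))
    {ψ : 𝔼 → ℝ} (hψ : ContDiff ℝ ∞ ψ) (hψc : HasCompactSupport ψ) :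
    ∀ᵐ t ∂(volume.restrict (Icc 0 T)), (n t).integral ψ = 0 := by
  have hψ1 : ContDiff ℝ 1 ψ := hψ.of_le (by simp)
  obtain ⟨B, hB⟩ := hψc.exists_bound_of_continuous hψ.continuous
  obtain ⟨L, hL⟩ := (hψc.fderiv (𝕜 := ℝ)).exists_bound_of_continuous
    (hψ1.continuous_fderiv one_ne_zero)
  have hB0 : 0 ≤ B := (norm_nonneg _).trans (hB 0)
  obtain ⟨G, hG0, hG⟩ := exists_scaled_cutoff 𝔼
  obtain ⟨N₀, hN₀⟩ := exists_subset_ball_nat (E := 𝔼) (IsCompact.isBounded hψc)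
  have hstep : ∀ N : ℕ, N₀ ≤ N → 0 < N → ∀ᵐ t ∂(volume.restrict (Icc 0 T)),
      ‖(n t).integral ψ‖ₑ ≤ ENNReal.ofReal (B * (G * (N : ℝ)⁻¹)) *
        ∫⁻ s in Icc 0 T, ∫⁻ x in {x | (N : ℝ) < ‖x‖ ∧ ‖x‖ < 2 * N}, ‖b x s‖ₑ ∂(n s).variation := by
    intro N hNN hN
    have hN' : (0 : ℝ) < N := by exact_mod_cast hN
    obtain ⟨φ, hφ, hφ01, hφ1, hφ0, hφG, hφA⟩ := hG N hN
    obtain ⟨η, hη, hη01, hη1, hη0, G₁, hG₁⟩ : ∃ η : 𝔼 → ℝ, ContDiff ℝ ∞ η ∧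
        (∀ x, 0 ≤ η x ∧ η x ≤ 1) ∧ (∀ x, ‖x‖ ≤ 2 * N → η x = 1) ∧
        (∀ x, 2 * N + 1 / 2 ≤ ‖x‖ → η x = 0) ∧ ∃ G₁ : ℝ, ∀ x, ‖fderiv ℝ η x‖ ≤ G₁ := by
      let f : ContDiffBump (0 : 𝔼) := ⟨2 * N, 2 * N + 1 / 2, by positivity, by linarith⟩
      have hfc : ContDiff ℝ 1 f := f.contDiff
      exact ⟨f, f.contDiff, fun x => ⟨f.nonneg, f.le_one⟩,
        fun x hx => f.one_of_mem_closedBall (by simpa [f] using hx),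
        fun x hx => f.zero_of_le_dist (by simpa [f] using hx),
        (f.hasCompactSupport.fderiv (𝕜 := ℝ)).exists_bound_of_continuous
          (hfc.continuous_fderiv one_ne_zero)⟩
    -- The cutoff `φ` lives in `‖x‖ ≤ 2 * N`, where `η = 1`; `η` vanishes from `2 * N + 1 / 2` on,
    -- and the radius `2 * N + 1` leaves room to extend the weight.
    obtain ⟨C, hC, δ, hδ, β, V, hβ, hV, ⟨c, hc, hVc⟩, hineq, hlim⟩ :=
      h_ii_iii (2 * N + 1) (by positivity)
    have hφψ : ∀ x, φ x * ψ x = ψ x := by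
      intro x
      by_cases hx : ‖x‖ ≤ N
      · rw [hφ1 x hx, one_mul]
      · have : ψ x = 0 := image_eq_zero_of_notMem_tsupport fun h => hx (by
          have := mem_ball_zero_iff.1 (hN₀ h)
          have h2 : (N₀ : ℝ) ≤ N := by exact_mod_cast hNN
          linarith)
        rw [this, mul_zero]
    have hAm : MeasurableSet {x : 𝔼 | (N : ℝ) < ‖x‖ ∧ ‖x‖ < 2 * N} :=
      (measurableSet_lt measurable_const measurable_norm).inter
        (measurableSet_lt measurable_norm measurable_const)
    have hk := fun k => ae_enorm_integral_le hT (r₀ := 2 * N) (r₁ := 2 * N + 1 / 2)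
      (r := 2 * N + 1) (by positivity) (by linarith) (by linarith) hη hη01 hη1 hη0 hG₁ (hβ k)
      (hV k) hc hC hδ (hVc k) (hineq k) hφ hφ01 hφ0 hφG hAm hφA hψ1 hL hB hφψ hb hn heq
    filter_upwards [ae_all_iff.2 hk] with t ht
    have hlim' := (ENNReal.Tendsto.const_mul hlim (Or.inr (ENNReal.ofReal_ne_top (r :=
      L * Real.sqrt (Real.exp ((C + 4 * G₁ ^ 2 / δ) * (T + 1)) / c))))).add_const
      (ENNReal.ofReal (B * (G * (N : ℝ)⁻¹)) * ∫⁻ s in Icc 0 T,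
        ∫⁻ x in {x | (N : ℝ) < ‖x‖ ∧ ‖x‖ < 2 * N}, ‖b x s‖ₑ ∂(n s).variation)
    rw [mul_zero, zero_add] at hlim'
    exact ge_of_tendsto' hlim' ht
  have hall : ∀ᵐ t ∂(volume.restrict (Icc 0 T)), ∀ N : ℕ, N₀ ≤ N → 0 < N →
      ‖(n t).integral ψ‖ₑ ≤ ENNReal.ofReal (B * (G * (N : ℝ)⁻¹)) *
        ∫⁻ s in Icc 0 T, ∫⁻ x in {x | (N : ℝ) < ‖x‖ ∧ ‖x‖ < 2 * N}, ‖b x s‖ₑ ∂(n s).variation := by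
    refine ae_all_iff.2 fun N => ?_
    by_cases h : N₀ ≤ N ∧ 0 < N
    · filter_upwards [hstep N h.1 h.2] with t ht _ _ using ht
    · exact Eventually.of_forall fun t h1 h2 => absurd ⟨h1, h2⟩ h
  filter_upwards [hall] with t ht
  have hlim := ENNReal.Tendsto.const_mul h_i (Or.inr (ENNReal.ofReal_ne_top (r := B * G)))
  rw [mul_zero] at hlim
  have : ‖(n t).integral ψ‖ₑ ≤ 0 := by
    refine ge_of_tendsto hlim ?_
    filter_upwards [eventually_ge_atTop N₀, eventually_gt_atTop 0] with N h1 h2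
    refine (ht N h1 h2).trans (le_of_eq ?_)
    have hN' : (0 : ℝ) < N := by exact_mod_cast h2
    rw [← mul_assoc, ← mul_assoc, ENNReal.ofReal_mul (mul_nonneg hB0 hG0),
      ENNReal.ofReal_inv_of_pos hN', ENNReal.ofReal_natCast]
  simpa using this

end Uniqueness

end

theorem theorem2 (d : ℕ) (T : ℝ) (hT : 0 < T)
    (b : EuclideanSpace ℝ (Fin d) → ℝ → EuclideanSpace ℝ (Fin d))
    (hb : Measurable (fun p : EuclideanSpace ℝ (Fin d) × ℝ => b p.1 p.2))
    (ν : LocBddMeasure (EuclideanSpace ℝ (Fin d)))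
    (μ₁ μ₂ : LocBddMeasure (EuclideanSpace ℝ (Fin d) × Icc (0 : ℝ) T))
    (m₁ m₂ : ℝ → LocBddMeasure (EuclideanSpace ℝ (Fin d)))
    (h₁ : IsSolution T b ν μ₁ m₁) (h₂ : IsSolution T b ν μ₂ m₂)
    (h_i : Tendsto (fun N : ℕ => (N : ℝ≥0∞)⁻¹ *
        ∫⁻ t in Icc 0 T, ∫⁻ x in {x | (N : ℝ) < ‖x‖ ∧ ‖x‖ < 2 * N},
          ‖b x t‖ₑ ∂(m₁ t - m₂ t).variation)
      atTop (𝓝 0))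
    (h_ii_iii : ∀ (z : EuclideanSpace ℝ (Fin d)) (r : ℝ), 0 < r →
      ∃ C : ℝ, 0 < C ∧ ∃ δ : ℝ, 0 < δ ∧
      ∃ (bk : ℕ → EuclideanSpace ℝ (Fin d) → ℝ → EuclideanSpace ℝ (Fin d))
        (V : ℕ → EuclideanSpace ℝ (Fin d) → ℝ),
        (∀ k, ContDiffOn ℝ ∞ (fun p : EuclideanSpace ℝ (Fin d) × ℝ => bk k p.1 p.2)
          (Metric.ball z r ×ˢ univ)) ∧
        (∀ k, ContDiffOn ℝ 1 (V k) (Metric.ball z r)) ∧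
        (∃ c : ℝ, 0 < c ∧ ∀ k, ∀ x ∈ Metric.ball z r, c ≤ V k x) ∧
        (∀ k, ∀ x ∈ Metric.ball z r, ∀ t ∈ Icc 0 T,
          inner ℝ (bk k x t) (gradient (V k) x) ≤
            (C - δ * ‖bk k x t‖ ^ 2 - 2 * maxQuadForm (fderiv ℝ (fun y => bk k y t) x))
              * V k x) ∧
        Tendsto (fun k => ∫⁻ t in Icc 0 T, ∫⁻ x in Metric.ball z r,
            ‖(Real.sqrt (V k x)) • (bk k x t - b x t)‖ₑ ∂(m₁ t - m₂ t).variation)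
          atTop (𝓝 0)) :
    μ₁ = μ₂ ∧ ∀ᵐ t ∂(volume.restrict (Icc 0 T)), m₁ t = m₂ t := by
  obtain ⟨n, hn, hae, heq⟩ := exists_measurable_difference hb h₁ h₂
  have hcongr : ∀ (F : ℝ → EuclideanSpace ℝ (Fin d) → ℝ≥0∞) (S : Set (EuclideanSpace ℝ (Fin d))),
      ∫⁻ t in Icc 0 T, ∫⁻ x in S, F t x ∂(m₁ t - m₂ t).variation
        = ∫⁻ t in Icc 0 T, ∫⁻ x in S, F t x ∂(n t).variation := fun F S =>
    lintegral_congr_ae (by filter_upwards [hae] with t ht; rw [ht])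
  have hzero : ∀ᵐ t ∂(volume.restrict (Icc 0 T)), n t = 0 := by
    refine LocBddMeasure.ae_eq_zero_of_forall_integral_eq_zero fun ψ hψ hψc =>
      ae_integral_eq_zero hT hb hn heq ?_ (fun r hr => ?_) hψ hψc
    · simpa only [hcongr fun t x => ‖b x t‖ₑ] using h_i
    · obtain ⟨C, hC, δ, hδ, bk, V, h1, h2, h3, h4, h5⟩ := h_ii_iii 0 r hr
      refine ⟨C, hC, δ, hδ, bk, V, h1, h2, h3, h4, ?_⟩
      refine h5.congr fun k => ?_
      exact hcongr (fun t x => ‖(Real.sqrt (V k x)) • (bk k x t - b x t)‖ₑ) _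
  have hm : ∀ᵐ t ∂(volume.restrict (Icc 0 T)), m₁ t = m₂ t := by
    filter_upwards [hae, hzero] with t h1 h2
    refine LocBddMeasure.ext_of_apply fun A _ _ => sub_eq_zero.1 ?_
    rw [← LocBddMeasure.sub_apply, h1, h2, LocBddMeasure.zero_apply]
  refine ⟨LocBddMeasure.ext_of_apply fun B hB hb => ?_, hm⟩
  rw [h₁.isGivenBy.eq_integral B hB hb, h₂.isGivenBy.eq_integral B hB hb]
  refine integral_congr_ae ?_
  -- Transfers the null set from `ℝ` restricted to `[0, T]` to the subtype on which `eq_integral`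
  -- integrates.
  rw [← map_comap_subtype_coe measurableSet_Icc,
    (MeasurableEmbedding.subtype_coe measurableSet_Icc).ae_map_iff] at hm
  filter_upwards [hm] with t ht
  rw [ht]
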